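/- **Setting.** An array of $n\ge 1$ distinct keys is sorted; "on average" refers to the uniform distribution over all $n!$ input permutations, and $\log$ is the logarithm to base $2$. *Quicksort* chooses a pivot in the current subarray, partitions the remaining elements of the subarray with Hoare's partitioner, puts the pivot between the two parts and recurses on the two parts (which do not contain the pivot), with no limit on the recursion depth; subarrays of at most $M_0$ elements, for a constant $M_0$, are sorted by Insertionsort. *BlockQuicksort* with block size $B\ge 1$ is the same algorithm (with a constant Insertionsort threshold $M$) with Hoare's partitioner replaced by the block partitioner: as long as more than $2B$ elements remain between the left and the right pointer, (i) if the left (right) buffer is empty, the next $B$ elements on the left (right) are compared with the pivot and the offsets of those that are $\ge$ (respectively $\le$) the pivot are stored in that buffer, without conditional jumps that depend on the comparisons; (ii) with $\mathrm{num}$ the minimum of the two buffer sizes, the first $\mathrm{num}$ elements of the left buffer are swapped with those of the right buffer and removed from the buffers; (iii) each pointer whose buffer is now empty advances by $B$. Finally the at most $2B$ remaining elements are scanned as one or two smaller blocks and rearranged in the same way, and the elements left in one buffer are moved to their side. A *pivot selection method with constant-size sample* selects, with at most a constant number $k$ of comparisons, one element from a sample of positions of the current subarray (positions and selection rule may depend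 on the boundaries of the subarray), such that whether a sample element is selected depends only on which elements of the sample are smaller than it (for example the median or another fixed order statistic of the sample, or a median of medians). *Median-of-three* selects the median of the first, the middle and the last element. *Static branch predictor*: there is one misprediction each time a loop is left, and one each time the condition of an *if* statement is false (the computation of a minimum is an *if* statement); there are no other mispredictions. **Theorem.** (a) For all constants $k, M_0, M$ there is a constant $K$ such that for every block size $B\ge1$, every pivot selection method with constant-size sample that uses at most $k$ comparisons, and every $n\ge1$: if $\mathcal C$ denotes the average number of comparisons of Quicksort with this pivot selection method on $n$ elements, then BlockQuicksort with block size $B$ and the same pivot selection method causes on average at most $$\frac{6}{B}\cdot\mathcal C+K\,n$$ branch mispredictions. (b) For every constant $M$ there is a constant $K$ such that for every $B\ge1$ and every $n\ge1$, BlockQuicksort with block size $B$ and median-of-three causes on average fewer than $$\frac{8}{B}\,n\log n+K\,n$$ branch mispredictions. -/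

import Mathlib

namespace BlockQuicksort

/-! ### A machine that counts key comparisons and branch mispredictions

The array is a function from indices to keys. A subarray is given by a half-open interval
`[l, e)` of indices. -/

/-- The array together with the counters. -/
structure Machine where
  mem : ℕ → ℕ
  comparisons : ℕ
  mispredictions : ℕ

abbrev Prog := StateM Machine

def readAt (i : ℕ) : Prog ℕ := do
  return (← get).mem i

def swapAt (i j : ℕ) : Prog Unit :=
  modify fun s => { s with mem := s.mem ∘ Equiv.swap i j }

/-- A comparison `x < y` of two keys. It does not cause a jump by itself. -/
def less (x y : ℕ) : Prog Bool := do
  modify fun s => { s with comparisons := s.comparisons + 1 }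
  return decide (x < y)

def mispredict : Prog Unit :=
  modify fun s => { s with mispredictions := s.mispredictions + 1 }

/-- The conditional jump of an `if c then … else …`. The static predictor always expects the
`if` branch, so there is a misprediction exactly if the condition `c` fails. Every `if` of the
algorithms is written as `branch c` followed by the case distinction on `c`. -/
def branch (c : Prop) [Decidable c] : Prog Unit :=
  if c then pure () else mispredict

/-- `body 0`, `body 1`, …, `body (m - 1)`, one after the other, passing on a local state. -/
def repeatBody {σ : Type} : ℕ → (ℕ → σ → Prog σ) → σ → Prog σ
  | 0, _, s => pure s
  | m + 1, body, s => do
    let t ← repeatBody m body s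
    body m t

/-- `for i = 0, …, m - 1 do body i`. The static predictor expects every loop to continue, so there
is exactly one misprediction, when the loop is left. The other loops below are recursive functions,
which call `mispredict` when they are left. -/
def forLoop {σ : Type} (m : ℕ) (body : ℕ → σ → Prog σ) (s : σ) : Prog σ := do
  let t ← repeatBody m body s
  mispredict
  return t

/-! ### Pivot selection -/

/-- A comparison-based selection of one array position: `test i j t f` compares the keys at `i`
and `j` and goes on with `t` if the key at `i` is the smaller one, with `f` otherwise. -/
inductive PivotTree where
  | take (i : ℕ) : PivotTree
  | test (i j : ℕ) (t f : PivotTree) : PivotTree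

namespace PivotTree

/-- The positions that the selection refers to, that is, the sample. -/
def sample : PivotTree → Finset ℕ
  | take i => {i}
  | test i j t f => {i, j} ∪ (t.sample ∪ f.sample)

/-- The largest number of comparisons on a path. -/
def depth : PivotTree → ℕ
  | take _ => 0
  | test _ _ t f => max t.depth f.depth + 1

/-- The position selected in the array `A`. -/
def choice (A : ℕ → ℕ) : PivotTree → ℕ
  | take i => i
  | test i j t f => if A i < A j then t.choice A else f.choice A

/-- Execution of the selection, every comparison being followed by a conditional jump. -/
def run : PivotTree → Prog ℕ
  | take i => pure i
  | test i j t f => do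
    let x ← readAt i
    let y ← readAt j
    let c ← less x y
    branch (c = true)
    if c then t.run else f.run

/-- For distinct keys, whether a sample element is selected depends only on which elements of the
sample are smaller than it. This is so for the median or any other fixed order statistic of the
sample and for medians of medians. -/
def IsRankBased (t : PivotTree) : Prop :=
  ∀ A A' : ℕ → ℕ, Set.InjOn A t.sample → Set.InjOn A' t.sample →
    (∀ i ∈ t.sample, A i < A (t.choice A) ↔ A' i < A' (t.choice A)) →
    t.choice A' = t.choice A

end PivotTree

/-- A pivot selection method: the selection used for the subarray `[l, e)`. -/
abbrev PivotMethod := ℕ → ℕ → PivotTree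

/-- The pivot is selected from a sample of constant size in the subarray, with at most `k`
comparisons. -/
structure PivotMethod.HasConstantSample (T : PivotMethod) (k : ℕ) : Prop where
  sample_subset : ∀ l e, l < e → (T l e).sample ⊆ Finset.Ico l e
  depth_le : ∀ l e, l < e → (T l e).depth ≤ k
  isRankBased : ∀ l e, l < e → (T l e).IsRankBased

/-- The median of the keys at the positions `a`, `b`, `c`. -/
def medianTree (a b c : ℕ) : PivotTree :=
  .test a b
    (.test b c (.take b) (.test a c (.take c) (.take a)))
    (.test a c (.take a) (.test b c (.take c) (.take b)))

/-- Median-of-three of the first, the middle and the last element. -/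
def medianOfThree : PivotMethod := fun l e => medianTree l (l + (e - l) / 2) (e - 1)

/-! ### Hoare's partitioner

All partitioners rearrange the elements of `[l, e)` and return a position `cut`, such that
the elements of `[l, cut)` are at most the pivot `p` and those of `[cut, e)` at least `p`. -/

/-- The loop `while A[l] < p do l++`, returning the number of steps. -/
def hoareScanLeft (p l e : ℕ) : Prog ℕ :=
  if l < e then do
    let x ← readAt l
    let c ← less x p
    if c then
      let a ← hoareScanLeft p (l + 1) e
      return a + 1
    else
      mispredict
      return 0
  else do
    mispredict
    return 0
termination_by e - l

/-- The loop `while A[r] > p do r--`, where `r = e - 1`, returning the number of steps. -/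
def hoareScanRight (p l e : ℕ) : Prog ℕ :=
  if l < e then do
    let x ← readAt (e - 1)
    let c ← less p x
    if c then
      let a ← hoareScanRight p l (e - 1)
      return a + 1
    else
      mispredict
      return 0
  else do
    mispredict
    return 0
termination_by e - l

def hoarePartition (p l e : ℕ) : Prog ℕ :=
  if l < e then do
    let a ← hoareScanLeft p l e
    let b ← hoareScanRight p (l + a) e
    branch (l + a + 1 < e - b)
    if l + a + 1 < e - b then
      swapAt (l + a) (e - b - 1)
      hoarePartition p (l + a + 1) (e - b - 1)
    else
      mispredict
      return l + a
  else do
    mispredict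
    return l
termination_by e - l

/-! ### The block partitioner -/

/-- A buffer of offsets: the entries with index `start, …, start + num - 1` are in use. -/
structure Buffer where
  offsets : ℕ → ℕ
  start : ℕ
  num : ℕ

def Buffer.empty : Buffer := ⟨fun _ => 0, 0, 0⟩

/-- Store the offset `i` and keep it exactly if `keep` holds (without a conditional jump). -/
def Buffer.push (b : Buffer) (i : ℕ) (keep : Bool) : Buffer :=
  { b with offsets := Function.update b.offsets b.num i, num := b.num + keep.toNat }

def Buffer.drop (b : Buffer) (k : ℕ) : Buffer :=
  { b with start := b.start + k, num := b.num - k }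

/-- Compare the element with offset `i` from the left end and store `i` if the element is at least
the pivot. -/
def scanStepLeft (p l i : ℕ) (b : Buffer) : Prog Buffer := do
  let x ← readAt (l + i)
  let c ← less x p
  return b.push i (!c)

/-- Compare the element with offset `i` from the right end and store `i` if the element is at most
the pivot. -/
def scanStepRight (p e i : ℕ) (b : Buffer) : Prog Buffer := do
  let x ← readAt (e - 1 - i)
  let c ← less p x
  return b.push i (!c)

def scanLeft (p l m : ℕ) : Prog Buffer := forLoop m (scanStepLeft p l) Buffer.empty

def scanRight (p e m : ℕ) : Prog Buffer := forLoop m (scanStepRight p e) Buffer.empty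

/-- The rearrangement phase: swap the first `k` elements of the left buffer with those of the right
buffer. -/
def swapPairs (l e : ℕ) (L R : Buffer) (k : ℕ) : Prog Unit :=
  forLoop k (fun j _ =>
    swapAt (l + L.offsets (L.start + j)) (e - 1 - R.offsets (R.start + j))) ()

/-- The main loop of the block partitioner, with block size `B`. -/
def blockMainLoop (B : ℕ+) (p l e : ℕ) (L R : Buffer) : Prog (ℕ × ℕ × Buffer × Buffer) :=
  if 2 * (B : ℕ) < e - l then do
    branch (L.num = 0)
    let L₁ ← if L.num = 0 then scanLeft p l B else pure L
    branch (R.num = 0)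
    let R₁ ← if R.num = 0 then scanRight p e B else pure R
    -- the minimum is computed by an `if`
    branch (L₁.num < R₁.num)
    let k := if L₁.num < R₁.num then L₁.num else R₁.num
    swapPairs l e L₁ R₁ k
    branch (L₁.num - k = 0)
    branch (R₁.num - k = 0)
    blockMainLoop B p
      (if L₁.num - k = 0 then l + B else l) (if R₁.num - k = 0 then e - B else e)
      (L₁.drop k) (R₁.drop k)
  else do
    mispredict
    return (l, e, L, R)
termination_by e - l
decreasing_by
  have := B.pos
  split_ifs <;> omega

/-- With `t` entries of the buffer left and the `u` outermost places considered, skip the last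
entries as long as they are already in place. -/
def skipPlaced (b : Buffer) : ℕ → ℕ → ℕ × ℕ
  | 0, u => (0, u)
  | t + 1, u => if b.offsets (b.start + t) + 1 = u then skipPlaced b t (u - 1) else (t + 1, u)

/-- Move the elements of the first `t` entries to the right end of the first `u` places of the
subarray that starts at `l`. -/
def moveRight (l : ℕ) (b : Buffer) : ℕ → ℕ → Prog Unit
  | 0, _ => mispredict
  | t + 1, u => do
    swapAt (l + (u - 1)) (l + b.offsets (b.start + t))
    moveRight l b t (u - 1)

/-- Move the elements of the first `t` entries to the left end of the last `u` places of the
subarray that ends before `e`. -/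
def moveLeft (e : ℕ) (b : Buffer) : ℕ → ℕ → Prog Unit
  | 0, _ => mispredict
  | t + 1, u => do
    swapAt (e - 1 - (u - 1)) (e - 1 - b.offsets (b.start + t))
    moveLeft e b t (u - 1)

/-- Scan what has not been scanned in the main loop, as one or two final blocks. The result holds
the two buffers and the sizes of the two blocks. -/
def finalScan (B : ℕ+) (p l e : ℕ) (L R : Buffer) : Prog (Buffer × Buffer × ℕ × ℕ) := do
  branch (R.num = 0 ∧ L.num = 0)
  if R.num = 0 ∧ L.num = 0 then
    let sL := (e - l) / 2
    let sR := (e - l) - sL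
    let (L₁, R₁) ← forLoop sL (fun j (b : Buffer × Buffer) => do
      let b₁ ← scanStepLeft p l j b.1
      let b₂ ← scanStepRight p e j b.2
      return (b₁, b₂)) (Buffer.empty, Buffer.empty)
    branch (sL < sR)
    let R₂ ← if sL < sR then scanStepRight p e (sR - 1) R₁ else pure R₁
    return (L₁, R₂, sL, sR)
  else
    branch (R.num ≠ 0)
    if R.num ≠ 0 then
      let L₁ ← scanLeft p l (e - l - B)
      return (L₁, R, e - l - B, (B : ℕ))
    else
      let R₁ ← scanRight p e (e - l - B)
      return (L, R₁, (B : ℕ), e - l - B)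

/-- One buffer at most is nonempty: move its elements to the right, respectively to the left. -/
def finalMove (l e : ℕ) (L R : Buffer) : Prog ℕ := do
  branch (L.num ≠ 0)
  if L.num ≠ 0 then
    let (t, u) := skipPlaced L L.num (e - l)
    mispredict
    moveRight l L t u
    return l + (u - t)
  else
    branch (R.num ≠ 0)
    if R.num ≠ 0 then
      let (t, u) := skipPlaced R R.num (e - l)
      mispredict
      moveLeft e R t u
      return e - (u - t)
    else
      return l

def blockPartition (B : ℕ+) (p l e : ℕ) : Prog ℕ := do
  let (l₁, e₁, L, R) ← blockMainLoop B p l e Buffer.empty Buffer.empty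
  let (L₁, R₁, sL, sR) ← finalScan B p l₁ e₁ L R
  branch (L₁.num < R₁.num)
  let k := if L₁.num < R₁.num then L₁.num else R₁.num
  swapPairs l₁ e₁ L₁ R₁ k
  branch (L₁.num - k = 0)
  branch (R₁.num - k = 0)
  finalMove
    (if L₁.num - k = 0 then l₁ + sL else l₁) (if R₁.num - k = 0 then e₁ - sR else e₁)
    (L₁.drop k) (R₁.drop k)

/-! ### Quicksort -/

/-- Move the element at `j` to its place in the sorted part `[l, j)`. -/
def insertElement (l : ℕ) : ℕ → Prog Unit
  | 0 => mispredict
  | j + 1 =>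
    if l < j + 1 then do
      let x ← readAt (j + 1)
      let y ← readAt j
      let c ← less x y
      if c then
        swapAt (j + 1) j
        insertElement l j
      else
        mispredict
    else mispredict

def insertionSort (l e : ℕ) : Prog Unit :=
  forLoop (e - l - 1) (fun i _ => insertElement l (l + 1 + i)) ()

/-- Quicksort of `[l, e)` with partitioner `part` and pivot selection `T`, without a limit to the
recursion depth. Subarrays of at most `M` elements are sorted by insertion (for `M = 1` nothing is
done with them). The pivot is kept at the right end during the partitioning and then moved to its
final position, which does not belong to the recursive calls. The position returned by a partitioner
lies in `[l, e - 1]`, so `max` and `min` have no effect except to make the termination evident. -/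
def quicksort (part : ℕ → ℕ → ℕ → Prog ℕ) (T : PivotMethod) (M l e : ℕ) : Prog Unit := do
  branch (M < e - l)
  if M < e - l then
    let q ← (T l e).run
    swapAt q (e - 1)
    let p ← readAt (e - 1)
    let c ← part p l (e - 1)
    let cut := max l (min c (e - 1))
    swapAt cut (e - 1)
    quicksort part T M l cut
    quicksort part T M (cut + 1) e
  else
    insertionSort l e
termination_by e - l
decreasing_by all_goals omega

/-- The array of length `n` that holds the permutation `π`, with all counters zero. -/
def initial {n : ℕ} (π : Equiv.Perm (Fin n)) : Machine where
  mem i := if h : i < n then (π ⟨i, h⟩ : ℕ) else 0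
  comparisons := 0
  mispredictions := 0

/-- The state after sorting the permutation `π`. -/
def sorted (part : ℕ → ℕ → ℕ → Prog ℕ) (T : PivotMethod) (M : ℕ) {n : ℕ}
    (π : Equiv.Perm (Fin n)) : Machine :=
  ((quicksort part T M 0 n).run (initial π)).2

/-- The average over all permutations of `n` elements. -/
noncomputable def average {n : ℕ} (f : Equiv.Perm (Fin n) → ℕ) : ℝ :=
  (∑ π, (f π : ℝ)) / (n.factorial : ℝ)

/-- The average number of comparisons of Quicksort (with Hoare's partitioner). -/
noncomputable def quicksortComparisons (T : PivotMethod) (M n : ℕ) : ℝ :=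
  average fun π : Equiv.Perm (Fin n) => (sorted hoarePartition T M π).comparisons

/-- The average number of branch mispredictions of BlockQuicksort with block size `B`. -/
noncomputable def blockQuicksortMispredictions (B : ℕ+) (T : PivotMethod) (M n : ℕ) : ℝ :=
  average fun π : Equiv.Perm (Fin n) => (sorted (blockPartition B) T M π).mispredictions

end BlockQuicksort

namespace BlockQuicksort

/-! One pass of the block main loop consumes at least `B` elements and causes at most five
mispredictions: one for each buffer (either the test fails or the scanning loop is left), one for
the minimum, one for leaving the swap loop, and one for the last two tests, of which at most one
fails because the minimum exhausts a buffer. Hence a call for `N ≥ 1` elements costs at most `5 / B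
* (N - 1)` mispredictions plus a constant. A run has at most `n` nonempty calls, since each of them
settles a key for good, so the constants add up to O(n). Hoare's partitioner, on the other hand,
compares each of the `N - 1` other keys with the pivot at least once.

It remains to compare the sums of `N - 1` over the recursive calls of the two algorithms. On a fixed
input they may differ, because the partitioners leave the keys in different orders; their averages
agree (`averageTollSum_eq`). The reason is that both partitioners use the keys only through
comparisons with the pivot (`IsPartitioner`, expressed by `Triple`), and that a rank-based selection
does not notice a permutation of the keys on one side of the pivot. Such a permutation therefore
commutes with partitioning, and all arrangements of the keys on either side are equally likely
afterwards (`sum_tollSum_side`). The average then satisfies a recurrence that involves only the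
distribution of the pivot (`sum_tollSum`). This gives (a), even with 5 in place of 6.

For (b), the average of the sum of `N - 1` under median-of-three is at most `2 N ln N`
(`averageTollSum_medianOfThree_le`). If the pivot leaves `r` and `s` keys on its sides and `u = r +
s = N - 1`, a second-order estimate of the logarithm gives `r ln r + s ln s ≤ u ln u - 5 r s / (2
u)`. The median of three has rank `r` with probability proportional to `r s`, so that `r s` has mean
`(u ^ 2 + 1) / 5`, and twice the gain is on average `u + 1 / u`, which pays for the toll `u`.
Finally `5 * 2 * ln 2 < 8`. -/

/-! ### Programs that use the keys only through comparisons with a pivot -/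

/-- On `[l, e)` the keys of both arrays compare in the same way with `p`. -/
def Agree (p l e : ℕ) (m m' : ℕ → ℕ) : Prop :=
  ∀ i, l ≤ i → i < e → (m i < p ↔ m' i < p) ∧ (p < m i ↔ p < m' i)

def SupportedIn (ρ : Equiv.Perm ℕ) (l e : ℕ) : Prop :=
  ∀ i, ¬ (l ≤ i ∧ i < e) → ρ i = i

/-- Keys are distinct, so this holds once the pivot is parked outside the interval. It turns the
failure of `m i < p` into `p < m i`, which makes "at least" in the partitioners strict. -/
def Avoids (p l e : ℕ) (m : ℕ → ℕ) : Prop := ∀ i, l ≤ i → i < e → m i ≠ p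

theorem SupportedIn.refl (l e : ℕ) : SupportedIn (Equiv.refl ℕ) l e := fun _ _ => rfl

theorem SupportedIn.swap {i j l e : ℕ} (hi : l ≤ i ∧ i < e) (hj : l ≤ j ∧ j < e) :
    SupportedIn (Equiv.swap i j) l e := by
  intro x hx
  apply Equiv.swap_apply_of_ne_of_ne <;> rintro rfl <;> contradiction

theorem SupportedIn.trans {ρ τ : Equiv.Perm ℕ} {l e : ℕ} (h : SupportedIn ρ l e)
    (h' : SupportedIn τ l e) : SupportedIn (τ.trans ρ) l e := by
  intro i hi
  simp [h' i hi, h i hi]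

theorem SupportedIn.mono {ρ : Equiv.Perm ℕ} {l e l' e' : ℕ} (h : SupportedIn ρ l e)
    (hl : l' ≤ l) (he : e ≤ e') : SupportedIn ρ l' e' :=
  fun i hi => h i (by omega)

theorem SupportedIn.mem {ρ : Equiv.Perm ℕ} {l e i : ℕ} (h : SupportedIn ρ l e)
    (hi : l ≤ i ∧ i < e) : l ≤ ρ i ∧ ρ i < e := by
  by_contra hc
  have := ρ.injective (h _ hc)
  rw [this] at hc
  exact hc hi

theorem Agree.refl (p l e : ℕ) (m : ℕ → ℕ) : Agree p l e m m := fun _ _ _ => ⟨Iff.rfl, Iff.rfl⟩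

theorem Agree.comp {p l e : ℕ} {m m' : ℕ → ℕ} (h : Agree p l e m m') {ρ : Equiv.Perm ℕ}
    (hρ : SupportedIn ρ l e) : Agree p l e (m ∘ ρ) (m' ∘ ρ) :=
  fun _ hi hi' => h _ (hρ.mem ⟨hi, hi'⟩).1 (hρ.mem ⟨hi, hi'⟩).2

theorem Avoids.comp {p l e : ℕ} {m : ℕ → ℕ} (h : Avoids p l e m) {ρ : Equiv.Perm ℕ}
    (hρ : SupportedIn ρ l e) : Avoids p l e (m ∘ ρ) :=
  fun _ hi hi' => h _ (hρ.mem ⟨hi, hi'⟩).1 (hρ.mem ⟨hi, hi'⟩).2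

/-- Run on an array without the key `p` in `[l, e)` that satisfies `P`, the program rearranges
`[l, e)` such that `Q` holds for the result and the new array. The result and the
rearrangement depend only on the comparisons of the keys in `[l, e)` with `p`. -/
def Triple {α : Type} (p l e : ℕ) (P : (ℕ → ℕ) → Prop) (x : Prog α) (Q : α → (ℕ → ℕ) → Prop) :
    Prop :=
  ∀ m, Avoids p l e m → P m → ∃ (r : α) (ρ : Equiv.Perm ℕ), SupportedIn ρ l e ∧ Q r (m ∘ ρ) ∧
    ∀ s : Machine, Agree p l e m s.mem →
      (x.run s).1 = r ∧ (x.run s).2.mem = s.mem ∘ ρ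

namespace Triple

variable {α β σ : Type} {p l e : ℕ} {P P' : (ℕ → ℕ) → Prop}

theorem pure {r : α} {Q : α → (ℕ → ℕ) → Prop} (h : ∀ m, Avoids p l e m → P m → Q r m) :
    Triple p l e P (pure r) Q :=
  fun m hm hP => ⟨r, Equiv.refl ℕ, SupportedIn.refl l e, h m hm hP, fun _ _ => ⟨rfl, rfl⟩⟩

theorem bind {x : Prog α} {f : α → Prog β} {Q : α → (ℕ → ℕ) → Prop} {R : β → (ℕ → ℕ) → Prop}
    (hx : Triple p l e P x Q) (hf : ∀ r, Triple p l e (Q r) (f r) R) :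
    Triple p l e P (x >>= f) R := by
  intro m hm hP
  obtain ⟨r, ρ, hρ, hQ, hr⟩ := hx m hm hP
  obtain ⟨r', ρ', hρ', hR, hr'⟩ := hf r _ (hm.comp hρ) hQ
  refine ⟨r', ρ'.trans ρ, hρ.trans hρ', hR, fun s hs => ?_⟩
  obtain ⟨h₁, h₂⟩ := hr s hs
  -- Both arrays have undergone the same rearrangement, so they still agree and the second program
  -- treats them alike too.
  have hs' : Agree p l e (m ∘ ρ) (x.run s).2.mem := h₂ ▸ hs.comp hρ
  obtain ⟨h₃, h₄⟩ := hr' _ hs'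
  have hrun : (x >>= f).run s = (f (x.run s).1).run (x.run s).2 := rfl
  rw [hrun, h₁]
  exact ⟨h₃, by rw [h₄, h₂]; rfl⟩

theorem pre {x : Prog α} {Q : α → (ℕ → ℕ) → Prop} (hx : Triple p l e P' x Q)
    (h : ∀ m, Avoids p l e m → P m → P' m) : Triple p l e P x Q :=
  fun m hm hP => hx m hm (h m hm hP)

theorem post {x : Prog α} {Q Q' : α → (ℕ → ℕ) → Prop} (hx : Triple p l e P x Q)
    (h : ∀ r m, Avoids p l e m → Q r m → Q' r m) : Triple p l e P x Q' := by
  intro m hm hP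
  obtain ⟨r, ρ, hρ, hQ, hr⟩ := hx m hm hP
  exact ⟨r, ρ, hρ, h _ _ (hm.comp hρ) hQ, hr⟩

/-- Turns a fact about indices that was established by an earlier postcondition into an ordinary
hypothesis, available to `omega`. -/
theorem assume {x : Prog α} {Q : α → (ℕ → ℕ) → Prop} {φ : Prop}
    (h : φ → Triple p l e P x Q) : Triple p l e (fun m => φ ∧ P m) x Q :=
  fun m hm hP => h hP.1 m hm hP.2

theorem mispredict : Triple p l e P mispredict (fun _ => P) :=
  fun _ _ hP => ⟨(), Equiv.refl ℕ, SupportedIn.refl l e, hP, fun _ _ => ⟨rfl, rfl⟩⟩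

theorem branch {c : Prop} [Decidable c] : Triple p l e P (branch c) (fun _ => P) := by
  unfold BlockQuicksort.branch
  split_ifs
  · exact pure fun _ _ h => h
  · exact mispredict

theorem swapAt {i j : ℕ} {Q : Unit → (ℕ → ℕ) → Prop} (hi : l ≤ i ∧ i < e) (hj : l ≤ j ∧ j < e)
    (h : ∀ m, Avoids p l e m → P m → Q () (m ∘ Equiv.swap i j)) :
    Triple p l e P (swapAt i j) Q :=
  fun m hm hP => ⟨(), Equiv.swap i j, SupportedIn.swap hi hj, h m hm hP, fun _ _ => ⟨rfl, rfl⟩⟩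

theorem lessPivot {i : ℕ} {f : Bool → Prog α} {Q : α → (ℕ → ℕ) → Prop} (hi : l ≤ i ∧ i < e)
    (h : ∀ c, Triple p l e (fun m => P m ∧ c = decide (m i < p)) (f c) Q) :
    Triple p l e P (readAt i >>= fun x => less x p >>= f) Q := by
  intro m hm hP
  obtain ⟨r, ρ, hρ, hQ, hr⟩ := h (decide (m i < p)) m hm ⟨hP, rfl⟩
  refine ⟨r, ρ, hρ, hQ, fun s hs => ?_⟩
  have hrun : (readAt i >>= fun x => less x p >>= f).run s =
      (f (decide (s.mem i < p))).run { s with comparisons := s.comparisons + 1 } := rfl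
  have hc : decide (s.mem i < p) = decide (m i < p) := by
    simp only [(hs i hi.1 hi.2).1]
  rw [hrun, hc]
  exact hr { s with comparisons := s.comparisons + 1 } hs

theorem pivotLess {i : ℕ} {f : Bool → Prog α} {Q : α → (ℕ → ℕ) → Prop} (hi : l ≤ i ∧ i < e)
    (h : ∀ c, Triple p l e (fun m => P m ∧ c = decide (p < m i)) (f c) Q) :
    Triple p l e P (readAt i >>= fun x => less p x >>= f) Q := by
  intro m hm hP
  obtain ⟨r, ρ, hρ, hQ, hr⟩ := h (decide (p < m i)) m hm ⟨hP, rfl⟩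
  refine ⟨r, ρ, hρ, hQ, fun s hs => ?_⟩
  have hrun : (readAt i >>= fun x => less p x >>= f).run s =
      (f (decide (p < s.mem i))).run { s with comparisons := s.comparisons + 1 } := rfl
  have hc : decide (p < s.mem i) = decide (p < m i) := by
    simp only [(hs i hi.1 hi.2).2]
  rw [hrun, hc]
  exact hr { s with comparisons := s.comparisons + 1 } hs

theorem repeatBody {n : ℕ} {body : ℕ → σ → Prog σ} {t : σ} (I : ℕ → σ → (ℕ → ℕ) → Prop)
    (h : ∀ j < n, ∀ t, Triple p l e (I j t) (body j t) (I (j + 1))) :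
    Triple p l e (I 0 t) (repeatBody n body t) (I n) := by
  induction n with
  | zero => exact pure fun _ _ h => h
  | succ n ih => exact bind (ih fun j hj => h j (by omega)) fun t => h n (by omega) t

theorem forLoop {n : ℕ} {body : ℕ → σ → Prog σ} {t : σ} (I : ℕ → σ → (ℕ → ℕ) → Prop)
    (h : ∀ j < n, ∀ t, Triple p l e (I j t) (body j t) (I (j + 1))) :
    Triple p l e (I 0 t) (forLoop n body t) (I n) :=
  bind (repeatBody I h) fun _ => bind mispredict fun _ => pure fun _ _ h => h

end Triple

/-- The array is partitioned at `c`. -/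
def Partitioned (p l e c : ℕ) (m : ℕ → ℕ) : Prop :=
  (l ≤ c ∧ c ≤ e) ∧ (∀ i, l ≤ i → i < c → m i < p) ∧ ∀ i, c ≤ i → i < e → p < m i

/-- A correct partitioner that uses the keys only through comparisons with the pivot. -/
def IsPartitioner (part : ℕ → ℕ → ℕ → Prog ℕ) : Prop :=
  ∀ p l e, l ≤ e → Triple p l e (fun _ => True) (part p l e) (Partitioned p l e)

/-! ### Correctness of Hoare's partitioner -/

/-- The scan does not change the array; the arbitrary `P` serves as a frame that carries along what
is already known. -/
theorem hoareScanLeft_triple {p l₀ e₀ : ℕ} {P : (ℕ → ℕ) → Prop} (l e : ℕ) (hl : l₀ ≤ l)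
    (hle : l ≤ e) (he : e ≤ e₀) :
    Triple p l₀ e₀ P (hoareScanLeft p l e) fun a m => P m ∧ l + a ≤ e ∧
      (∀ i, l ≤ i → i < l + a → m i < p) ∧ (l + a < e → p < m (l + a)) := by
  induction h : e - l generalizing l P with
  | zero =>
    rw [hoareScanLeft, if_neg (by omega)]
    exact .bind .mispredict fun _ => .pure fun m _ hP =>
      ⟨hP, by omega, fun i _ _ => by omega, fun _ => by omega⟩
  | succ n ih =>
    rw [hoareScanLeft, if_pos (by omega)]
    refine .lessPivot (by omega) fun c => ?_
    cases c
    · refine .bind .mispredict fun _ => .pure fun m hm hP => ⟨hP.1, by omega, fun i _ _ => by omega,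
        fun _ => ?_⟩
      have h₁ := of_decide_eq_false hP.2.symm
      have h₂ := hm l hl (by omega)
      simp only [add_zero]
      omega
    · refine .bind (ih (l + 1) (by omega) (by omega) (by omega)) fun a => ?_
      refine .pure fun m _ ⟨⟨h₁, h₂⟩, h₃, h₄, h₅⟩ => ⟨h₁, by omega, fun i hi hi' => ?_, fun h => ?_⟩
      · rcases hi.eq_or_lt with rfl | hi
        · exact of_decide_eq_true h₂.symm
        · exact h₄ i hi (by omega)
      · have := h₅ (by omega)
        rwa [show l + (a + 1) = l + 1 + a by omega]

theorem hoareScanRight_triple {p l₀ e₀ : ℕ} {P : (ℕ → ℕ) → Prop} (l e : ℕ) (hl : l₀ ≤ l)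
    (hle : l ≤ e) (he : e ≤ e₀) :
    Triple p l₀ e₀ P (hoareScanRight p l e) fun b m => P m ∧ l + b ≤ e ∧
      (∀ i, e - b ≤ i → i < e → p < m i) ∧ (l < e - b → m (e - b - 1) < p) := by
  induction h : e - l generalizing e P with
  | zero =>
    rw [hoareScanRight, if_neg (by omega)]
    exact .bind .mispredict fun _ => .pure fun m _ hP =>
      ⟨hP, by omega, fun i _ _ => by omega, fun _ => by omega⟩
  | succ n ih =>
    rw [hoareScanRight, if_pos (by omega)]
    refine .pivotLess (by omega) fun c => ?_
    cases c
    · refine .bind .mispredict fun _ => .pure fun m hm hP => ⟨hP.1, by omega, fun i _ _ => by omega,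
        fun _ => ?_⟩
      have h₁ := of_decide_eq_false hP.2.symm
      have h₂ := hm (e - 1) (by omega) (by omega)
      simp only [Nat.sub_zero]
      omega
    · refine .bind (ih (e - 1) (by omega) (by omega) (by omega)) fun a => ?_
      refine .pure fun m _ ⟨⟨h₁, h₂⟩, h₃, h₄, h₅⟩ => ⟨h₁, by omega, fun i hi hi' => ?_, fun h => ?_⟩
      · rcases (Nat.le_sub_one_of_lt hi').eq_or_lt with rfl | hi'
        · exact of_decide_eq_true h₂.symm
        · exact h₄ i (by omega) hi'
      · have := h₅ (by omega)
        rwa [show e - (a + 1) - 1 = e - 1 - a - 1 by omega]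

/-- The outer interval `[l₀, e₀)` stays fixed while `[l, e)` shrinks around the part that is not yet
settled; what lies outside of `[l, e)` is already on its side. -/
theorem hoarePartition_triple {p l₀ e₀ : ℕ} (l e : ℕ) (hl : l₀ ≤ l) (hle : l ≤ e) (he : e ≤ e₀) :
    Triple p l₀ e₀
      (fun m => (∀ i, l₀ ≤ i → i < l → m i < p) ∧ ∀ i, e ≤ i → i < e₀ → p < m i)
      (hoarePartition p l e) (Partitioned p l₀ e₀) := by
  induction h : e - l using Nat.strong_induction_on generalizing l e with
  | _ n ih =>
  rw [hoarePartition]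
  split_ifs with hlt
  · refine .bind (hoareScanLeft_triple l e hl hle he) fun a => ?_
    refine .pre (P' := fun m => l + a ≤ e ∧ (∀ i, l₀ ≤ i → i < l + a → m i < p) ∧
      (∀ i, e ≤ i → i < e₀ → p < m i) ∧ (l + a < e → p < m (l + a))) ?_ ?_
    swap
    · rintro m - ⟨⟨h₁, h₂⟩, h₃, h₄, h₅⟩
      refine ⟨h₃, fun i hi hi' => ?_, h₂, h₅⟩
      by_cases hil : i < l
      · exact h₁ i hi hil
      · exact h₄ i (by omega) hi'
    refine .assume fun ha => ?_
    refine .bind (hoareScanRight_triple (l + a) e (by omega) ha he) fun b => ?_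
    refine .pre (P' := fun m => l + a + b ≤ e ∧ (∀ i, l₀ ≤ i → i < l + a → m i < p) ∧
      (∀ i, e - b ≤ i → i < e₀ → p < m i) ∧ (l + a < e → p < m (l + a)) ∧
      (l + a < e - b → m (e - b - 1) < p)) ?_ ?_
    swap
    · rintro m - ⟨⟨h₁, h₂, h₃⟩, h₄, h₅, h₆⟩
      refine ⟨h₄, h₁, fun i hi hi' => ?_, h₃, h₆⟩
      by_cases hil : i < e
      · exact h₅ i hi hil
      · exact h₂ i (by omega) hi'
    refine .assume fun hb => ?_
    refine .bind .branch fun _ => ?_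
    split_ifs with hab
    · refine .bind (.swapAt (by omega) (by omega) ?_) fun _ =>
        ih (e - b - 1 - (l + a + 1)) (by omega) (l + a + 1) (e - b - 1) (by omega) (by omega)
          (by omega) rfl
      rintro m - ⟨h₁, h₂, h₃, h₄⟩
      refine ⟨fun i hi hi' => ?_, fun i hi hi' => ?_⟩
      · rcases (Nat.le_of_lt_succ hi').eq_or_lt with rfl | hi'
        · simpa using h₄ (by omega)
        · simpa [Equiv.swap_apply_of_ne_of_ne (show i ≠ l + a by omega)
            (show i ≠ e - b - 1 by omega)] using h₁ i hi hi'
      · rcases hi.eq_or_lt with rfl | hi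
        · simpa using h₃ (by omega)
        · simpa [Equiv.swap_apply_of_ne_of_ne (show i ≠ l + a by omega)
            (show i ≠ e - b - 1 by omega)] using h₂ i (by omega) hi'
    · refine .bind .mispredict fun _ => .pure ?_
      rintro m - ⟨h₁, h₂, h₃, h₄⟩
      refine ⟨by omega, h₁, fun i hi hi' => ?_⟩
      -- If the scans stopped before meeting, they stopped at the same element, which would be both
      -- larger and smaller than the pivot.
      by_cases hc : l + a < e - b
      · have h₅ := h₃ (by omega)
        have h₆ := h₄ hc
        rw [show e - b - 1 = l + a by omega] at h₆
        omega
      · exact h₂ i (by omega) hi'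
  · refine .bind .mispredict fun _ => .pure ?_
    rintro m - ⟨h₁, h₂⟩
    exact ⟨by omega, h₁, fun i hi hi' => h₂ i (by omega) hi'⟩

theorem isPartitioner_hoarePartition : IsPartitioner hoarePartition := fun _ l e h =>
  (hoarePartition_triple l e le_rfl h le_rfl).pre fun _ _ _ =>
    ⟨fun _ _ _ => by omega, fun _ _ _ => by omega⟩

/-! ### Correctness of the block partitioner -/

/-- The buffer lists in increasing order the offsets `i < n` for which the key at position `pos i`
is on the wrong side. -/
def Buffer.Lists (b : Buffer) (pos : ℕ → ℕ) (n : ℕ) (bad : ℕ → Prop) (m : ℕ → ℕ) : Prop :=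
  (∀ j j', j < j' → j' < b.num → b.offsets (b.start + j) < b.offsets (b.start + j')) ∧
    ∀ i, (∃ j, j < b.num ∧ b.offsets (b.start + j) = i) ↔ i < n ∧ bad (m (pos i))

namespace Buffer.Lists

variable {b : Buffer} {pos : ℕ → ℕ} {n : ℕ} {bad : ℕ → Prop} {m : ℕ → ℕ}

theorem offset_lt (h : b.Lists pos n bad m) {j : ℕ} (hj : j < b.num) :
    b.offsets (b.start + j) < n :=
  ((h.2 _).1 ⟨j, hj, rfl⟩).1

theorem bad_offset (h : b.Lists pos n bad m) {j : ℕ} (hj : j < b.num) :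
    bad (m (pos (b.offsets (b.start + j)))) :=
  ((h.2 _).1 ⟨j, hj, rfl⟩).2

theorem not_bad (h : b.Lists pos n bad m) (hb : b.num = 0) {i : ℕ} (hi : i < n) :
    ¬ bad (m (pos i)) := by
  intro hbad
  obtain ⟨j, hj, -⟩ := (h.2 i).2 ⟨hi, hbad⟩
  omega

theorem empty : Buffer.empty.Lists pos 0 bad m :=
  ⟨fun _ _ _ h => by simp [Buffer.empty] at h, fun i => by simp [Buffer.empty]⟩

/-- `Buffer.push` writes at index `num`, which is the first free entry only if the buffer starts at
index 0. -/
theorem push (h : b.Lists pos n bad m) (h₀ : b.start = 0) {c : Bool}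
    (hc : c = true ↔ bad (m (pos n))) : (b.push n c).Lists pos (n + 1) bad m := by
  obtain ⟨off, st, num⟩ := b
  obtain rfl : st = 0 := h₀
  obtain ⟨h₁, h₂⟩ := h
  simp only [zero_add] at h₁ h₂
  have hlt : ∀ j, j < num → off j < n := fun j hj => ((h₂ _).1 ⟨j, hj, rfl⟩).1
  cases c
  · simp only [Buffer.push, Bool.toNat_false, add_zero]
    refine ⟨fun j j' hj hj' => ?_, fun i => ?_⟩
    · simp only [zero_add]
      simp only at hj'
      rw [Function.update_of_ne (by omega), Function.update_of_ne (by omega)]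
      exact h₁ j j' hj hj'
    · simp only [zero_add]
      have : (∃ j, j < num ∧ Function.update off num n j = i) ↔ ∃ j, j < num ∧ off j = i := by
        refine exists_congr fun j => and_congr_right fun hj => ?_
        rw [Function.update_of_ne (by omega)]
      rw [this, h₂]
      constructor
      · rintro ⟨hi, hb⟩
        exact ⟨by omega, hb⟩
      · rintro ⟨hi, hb⟩
        refine ⟨?_, hb⟩
        rcases (Nat.le_of_lt_succ hi).eq_or_lt with rfl | hi
        · simp [hb] at hc
        · exact hi
  · simp only [Buffer.push, Bool.toNat_true]
    refine ⟨fun j j' hj hj' => ?_, fun i => ?_⟩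
    · simp only [zero_add]
      simp only at hj'
      rw [Function.update_of_ne (by omega)]
      rcases (Nat.le_of_lt_succ hj').eq_or_lt with rfl | hj''
      · simpa using hlt j hj
      · rw [Function.update_of_ne (by omega)]
        exact h₁ j j' hj hj''
    · simp only [zero_add]
      constructor
      · rintro ⟨j, hj, rfl⟩
        rcases (Nat.le_of_lt_succ hj).eq_or_lt with rfl | hj
        · simpa using hc
        · rw [Function.update_of_ne (by omega)]
          have := (h₂ _).1 ⟨j, hj, rfl⟩
          exact ⟨by omega, this.2⟩
      · rintro ⟨hi, hb⟩
        rcases (Nat.le_of_lt_succ hi).eq_or_lt with rfl | hi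
        · exact ⟨num, by omega, by simp⟩
        · obtain ⟨j, hj, rfl⟩ := (h₂ i).2 ⟨hi, hb⟩
          exact ⟨j, by omega, Function.update_of_ne (by omega) _ _⟩

/-- Exchanging the first listed key with a good one from elsewhere. -/
theorem swap_first (h : b.Lists pos n bad m) (hb : 0 < b.num)
    (hpos : ∀ i < n, ∀ i' < n, pos i = pos i' → i = i') {y : ℕ} (hy : ∀ i < n, pos i ≠ y)
    (hgood : ¬ bad (m y)) :
    (b.drop 1).Lists pos n bad (m ∘ Equiv.swap (pos (b.offsets b.start)) y) := by
  have h₀ : b.offsets b.start < n := by simpa using h.offset_lt hb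
  refine ⟨fun j j' hj hj' => ?_, fun i => ?_⟩
  · simp only [Buffer.drop] at hj' ⊢
    have := h.1 (1 + j) (1 + j') (by omega) (by omega)
    simpa only [add_assoc] using this
  · have hshift : (∃ j, j < (b.drop 1).num ∧ (b.drop 1).offsets ((b.drop 1).start + j) = i) ↔
        (∃ j, j < b.num ∧ b.offsets (b.start + j) = i) ∧ i ≠ b.offsets b.start := by
      simp only [Buffer.drop]
      constructor
      · rintro ⟨j, hj, rfl⟩
        have := h.1 0 (1 + j) (by omega) (by omega)
        simp only [add_zero, ← add_assoc] at this
        exact ⟨⟨1 + j, by omega, by rw [add_assoc]⟩, this.ne'⟩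
      · rintro ⟨⟨j, hj, rfl⟩, hne⟩
        have : j ≠ 0 := by rintro rfl; simp at hne
        exact ⟨j - 1, by omega, by rw [show b.start + 1 + (j - 1) = b.start + j by omega]⟩
    rw [hshift, h.2]
    by_cases hi : i < n
    · by_cases hio : i = b.offsets b.start
      · subst hio
        simp [hgood]
      · have : pos i ≠ pos (b.offsets b.start) := fun hc => hio (hpos _ hi _ h₀ hc)
        simp [hio, Equiv.swap_apply_of_ne_of_ne this (hy i hi)]
    · simp [hi]

/-- Exchanging the last listed key with the outermost one. -/
theorem swap_last {off : ℕ → ℕ} {st t : ℕ} (h : Lists ⟨off, st, t + 1⟩ pos n bad m)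
    (hpos : ∀ i < n, ∀ i' < n, pos i = pos i' → i = i') :
    Lists ⟨off, st, t⟩ pos (n - 1) bad (m ∘ Equiv.swap (pos (n - 1)) (pos (off (st + t)))) ∧
      bad ((m ∘ Equiv.swap (pos (n - 1)) (pos (off (st + t)))) (pos (n - 1))) := by
  have ht : off (st + t) < n := h.offset_lt (j := t) (Nat.lt_succ_self t)
  have hbad : bad (m (pos (off (st + t)))) := h.bad_offset (j := t) (Nat.lt_succ_self t)
  have hmax : ∀ j, j < t → off (st + j) < off (st + t) := fun j hj =>
    h.1 j t hj (Nat.lt_succ_self t)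
  refine ⟨⟨fun j j' hj hj' => h.1 j j' hj (by simp only at hj' ⊢; omega), fun i => ?_⟩, ?_⟩
  · have hshift : (∃ j, j < t ∧ off (st + j) = i) ↔
        (∃ j, j < t + 1 ∧ off (st + j) = i) ∧ i ≠ off (st + t) := by
      constructor
      · rintro ⟨j, hj, rfl⟩
        exact ⟨⟨j, by omega, rfl⟩, (hmax j hj).ne⟩
      · rintro ⟨⟨j, hj, rfl⟩, hne⟩
        have : j ≠ t := by rintro rfl; exact hne rfl
        exact ⟨j, by omega, rfl⟩
    have h₂ := h.2 i
    simp only at h₂ ⊢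
    rw [hshift, h₂]
    by_cases hi : i < n - 1
    · have hne : pos i ≠ pos (n - 1) := fun hc => by
        have := hpos _ (by omega) _ (by omega) hc
        omega
      by_cases hio : i = off (st + t)
      · subst hio
        simp only [ne_eq, not_true_eq_false, and_false, Function.comp, Equiv.swap_apply_right,
          false_iff, not_and]
        -- Place `i` now holds the key that was outermost. Were that key bad, `n - 1` would have
        -- been listed, although the largest listed offset is `i < n - 1`.
        intro _ hb
        obtain ⟨j, hj, hj'⟩ := (h.2 (n - 1)).2 ⟨by omega, hb⟩
        simp only at hj hj'
        rcases (Nat.le_of_lt_succ hj).eq_or_lt with rfl | hj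
        · omega
        · have := hmax j hj
          omega
      · have : pos i ≠ pos (off (st + t)) := fun hc => hio (hpos _ (by omega) _ ht hc)
        simp [hio, Equiv.swap_apply_of_ne_of_ne hne this, hi, show i < n by omega]
    · simp only [hi, false_and, iff_false, not_and, not_not]
      rintro ⟨hi', hb⟩
      obtain ⟨j, hj, hj'⟩ := h₂.2 ⟨hi', hb⟩
      rcases (Nat.le_of_lt_succ hj).eq_or_lt with rfl | hj
      · exact hj'.symm
      · have := hmax j hj
        omega
  · simpa using hbad

/-- The case in which the last listed key is already outermost, so that no exchange is needed; this
is what `skipPlaced` detects. -/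
theorem drop_last {off : ℕ → ℕ} {st t : ℕ} (h : Lists ⟨off, st, t + 1⟩ pos n bad m)
    (ht : off (st + t) + 1 = n) : Lists ⟨off, st, t⟩ pos (n - 1) bad m ∧ bad (m (pos (n - 1))) := by
  have hbad : bad (m (pos (off (st + t)))) := h.bad_offset (j := t) (Nat.lt_succ_self t)
  have hmax : ∀ j, j < t → off (st + j) < off (st + t) := fun j hj =>
    h.1 j t hj (Nat.lt_succ_self t)
  refine ⟨⟨fun j j' hj hj' => h.1 j j' hj (by simp only at hj' ⊢; omega), fun i => ?_⟩, ?_⟩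
  · constructor
    · rintro ⟨j, hj, rfl⟩
      exact ⟨by have := hmax j hj; simp only; omega,
        h.bad_offset (j := j) (by simp only at hj ⊢; omega)⟩
    · rintro ⟨hi, hb⟩
      obtain ⟨j, hj, rfl⟩ := (h.2 i).2 ⟨by omega, hb⟩
      simp only at hj hi ⊢
      rcases (Nat.le_of_lt_succ hj).eq_or_lt with rfl | hj
      · omega
      · exact ⟨j, hj, rfl⟩
  · rwa [← ht]

end Buffer.Lists

theorem scanStepLeft_triple {p l₀ e₀ l n : ℕ} {b : Buffer} {P : (ℕ → ℕ) → Prop} (hl : l₀ ≤ l)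
    (he : l + n < e₀) :
    Triple p l₀ e₀ (fun m => P m ∧ b.start = 0 ∧ b.Lists (l + ·) n (p < ·) m)
      (scanStepLeft p l n b)
      fun b m => P m ∧ b.start = 0 ∧ b.Lists (l + ·) (n + 1) (p < ·) m := by
  refine .lessPivot (by omega) fun c => .pure ?_
  rintro m hm ⟨⟨hP, h₁, h₂⟩, hc⟩
  refine ⟨hP, h₁, h₂.push h₁ ?_⟩
  have := hm (l + n) (by omega) (by omega)
  simp only [hc, Bool.not_eq_true', decide_eq_false_iff_not]
  omega

theorem scanStepRight_triple {p l₀ e₀ e n : ℕ} {b : Buffer} {P : (ℕ → ℕ) → Prop}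
    (hl : l₀ + n < e) (he : e ≤ e₀) :
    Triple p l₀ e₀ (fun m => P m ∧ b.start = 0 ∧ b.Lists (e - 1 - ·) n (· < p) m)
      (scanStepRight p e n b)
      fun b m => P m ∧ b.start = 0 ∧ b.Lists (e - 1 - ·) (n + 1) (· < p) m := by
  refine .pivotLess (by omega) fun c => .pure ?_
  rintro m hm ⟨⟨hP, h₁, h₂⟩, hc⟩
  refine ⟨hP, h₁, h₂.push h₁ ?_⟩
  have := hm (e - 1 - n) (by omega) (by omega)
  simp only [hc, Bool.not_eq_true', decide_eq_false_iff_not]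
  omega

theorem scanLeft_triple {p l₀ e₀ l n : ℕ} {P : (ℕ → ℕ) → Prop} (hl : l₀ ≤ l) (he : l + n ≤ e₀) :
    Triple p l₀ e₀ P (scanLeft p l n) fun b m => P m ∧ b.Lists (l + ·) n (p < ·) m :=
  ((Triple.forLoop (fun j b m => P m ∧ b.start = 0 ∧ b.Lists (l + ·) j (p < ·) m)
    fun _ _ _ => scanStepLeft_triple hl (by omega)).pre
      fun _ _ h => ⟨h, rfl, .empty⟩).post fun _ _ _ h => ⟨h.1, h.2.2⟩

theorem scanRight_triple {p l₀ e₀ e n : ℕ} {P : (ℕ → ℕ) → Prop} (hl : l₀ + n ≤ e) (he : e ≤ e₀) :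
    Triple p l₀ e₀ P (scanRight p e n) fun b m => P m ∧ b.Lists (e - 1 - ·) n (· < p) m :=
  ((Triple.forLoop (fun j b m => P m ∧ b.start = 0 ∧ b.Lists (e - 1 - ·) j (· < p) m)
    fun _ _ _ => scanStepRight_triple (by omega) he).pre
      fun _ _ h => ⟨h, rfl, .empty⟩).post fun _ _ _ h => ⟨h.1, h.2.2⟩

/-- The keys of `[l₀, l)` are smaller and those of `[e, e₀)` larger than `p`. -/
def Outside (p l₀ e₀ l e : ℕ) (m : ℕ → ℕ) : Prop :=
  (∀ i, l₀ ≤ i → i < l → m i < p) ∧ ∀ i, e ≤ i → i < e₀ → p < m i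

theorem Outside.swap {p l₀ e₀ l e i j : ℕ} {m : ℕ → ℕ} (h : Outside p l₀ e₀ l e m)
    (hi : l ≤ i ∧ i < e) (hj : l ≤ j ∧ j < e) : Outside p l₀ e₀ l e (m ∘ Equiv.swap i j) := by
  refine ⟨fun a ha ha' => ?_, fun a ha ha' => ?_⟩
  · simpa [Equiv.swap_apply_of_ne_of_ne (show a ≠ i by omega) (show a ≠ j by omega)]
      using h.1 a ha ha'
  · simpa [Equiv.swap_apply_of_ne_of_ne (show a ≠ i by omega) (show a ≠ j by omega)]
      using h.2 a ha ha'

/-- The situation when the outermost `nL` and `nR` elements of `[l, e)` have been scanned. -/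
def Scanned (p l₀ e₀ l e nL nR : ℕ) (L R : Buffer) (m : ℕ → ℕ) : Prop :=
  Outside p l₀ e₀ l e m ∧ L.Lists (l + ·) nL (p < ·) m ∧ R.Lists (e - 1 - ·) nR (· < p) m

theorem swapPairs_triple {p l₀ e₀ l e nL nR k : ℕ} {L R : Buffer} (hl : l₀ ≤ l)
    (hle : l + nL + nR ≤ e) (he : e ≤ e₀) (hL : k ≤ L.num) (hR : k ≤ R.num) :
    Triple p l₀ e₀ (Scanned p l₀ e₀ l e nL nR L R) (swapPairs l e L R k)
      fun _ => Scanned p l₀ e₀ l e nL nR (L.drop k) (R.drop k) := by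
  refine Triple.forLoop
    (fun j _ => Scanned p l₀ e₀ l e nL nR (L.drop j) (R.drop j)) fun j hj _ => ?_
  rintro m hm ⟨hO, hLl, hRl⟩
  have hjL : 0 < (L.drop j).num := by simp only [Buffer.drop]; omega
  have hjR : 0 < (R.drop j).num := by simp only [Buffer.drop]; omega
  have haL : L.offsets (L.start + j) < nL := by simpa [Buffer.drop] using hLl.offset_lt hjL
  have haR : R.offsets (R.start + j) < nR := by simpa [Buffer.drop] using hRl.offset_lt hjR
  have hbL : p < m (l + L.offsets (L.start + j)) := by
    simpa [Buffer.drop] using hLl.bad_offset hjL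
  have hbR : m (e - 1 - R.offsets (R.start + j)) < p := by
    simpa [Buffer.drop] using hRl.bad_offset hjR
  -- The positions to be exchanged are known to lie in the interval only because of the listing in
  -- the present array, so the swap rule is applied with that single array as precondition.
  have hstep := Triple.swapAt (p := p) (l := l₀) (e := e₀)
    (P := fun m' => m' = m) (i := l + L.offsets (L.start + j))
    (j := e - 1 - R.offsets (R.start + j))
    (Q := fun _ => Scanned p l₀ e₀ l e nL nR (L.drop (j + 1)) (R.drop (j + 1)))
    (by omega) (by omega) ?_
  · exact hstep m hm rfl
  rintro _ - rfl
  refine ⟨hO.swap (by omega) (by omega), ?_, ?_⟩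
  · have := hLl.swap_first hjL (fun i hi i' hi' h => by omega)
      (y := e - 1 - R.offsets (R.start + j)) (fun i hi => by omega) (by omega)
    simpa [Buffer.drop, add_assoc, Nat.sub_sub] using this
  · rw [Equiv.swap_comm]
    have := hRl.swap_first hjR (fun i hi i' hi' h => by omega)
      (y := l + L.offsets (L.start + j)) (fun i hi => by omega) (by omega)
    simpa [Buffer.drop, add_assoc, Nat.sub_sub] using this

/-- An empty buffer certifies that the scanned block has no key on the wrong side, so the pointer
may pass over the whole block. -/
theorem Outside.advance_left {p l₀ e₀ l e n : ℕ} {m : ℕ → ℕ} {L : Buffer}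
    (h : Outside p l₀ e₀ l e m) (hm : Avoids p l₀ e₀ m) (he : l + n ≤ e₀)
    (hL : L.Lists (l + ·) n (p < ·) m) (h₀ : L.num = 0) : Outside p l₀ e₀ (l + n) e m := by
  refine ⟨fun i hi hi' => ?_, h.2⟩
  by_cases hil : i < l
  · exact h.1 i hi hil
  · have h₁ := hL.not_bad h₀ (show i - l < n by omega)
    have h₂ := hm i hi (by omega)
    simp only [show l + (i - l) = i by omega] at h₁
    omega

theorem Outside.advance_right {p l₀ e₀ l e n : ℕ} {m : ℕ → ℕ} {R : Buffer}
    (h : Outside p l₀ e₀ l e m) (hm : Avoids p l₀ e₀ m) (hl : l₀ + n ≤ e)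
    (hR : R.Lists (e - 1 - ·) n (· < p) m) (h₀ : R.num = 0) : Outside p l₀ e₀ l (e - n) m := by
  refine ⟨h.1, fun i hi hi' => ?_⟩
  by_cases hie : e ≤ i
  · exact h.2 i hie hi'
  · have h₁ := hR.not_bad h₀ (show e - 1 - i < n by omega)
    have h₂ := hm i (by omega) (by omega)
    simp only [show e - 1 - (e - 1 - i) = i by omega] at h₁
    omega

/-- The invariant of the main loop. -/
def LoopInvariant (B p l₀ e₀ l e : ℕ) (L R : Buffer) (m : ℕ → ℕ) : Prop :=
  Outside p l₀ e₀ l e m ∧ (L.num = 0 ∨ R.num = 0) ∧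
    (L.num ≠ 0 → l + B ≤ e ∧ L.Lists (l + ·) B (p < ·) m) ∧
    (R.num ≠ 0 → l + B ≤ e ∧ R.Lists (e - 1 - ·) B (· < p) m)

/-- One pass of the main loop up to the next test of the loop condition. -/
def blockPass (B : ℕ+) (p l e : ℕ) (L R : Buffer) : Prog (ℕ × ℕ × Buffer × Buffer) := do
  branch (L.num = 0)
  let L₁ ← (if L.num = 0 then scanLeft p l B else pure L : Prog Buffer)
  branch (R.num = 0)
  let R₁ ← (if R.num = 0 then scanRight p e B else pure R : Prog Buffer)
  branch (L₁.num < R₁.num)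
  swapPairs l e L₁ R₁ (if L₁.num < R₁.num then L₁.num else R₁.num)
  branch (L₁.num - (if L₁.num < R₁.num then L₁.num else R₁.num) = 0)
  branch (R₁.num - (if L₁.num < R₁.num then L₁.num else R₁.num) = 0)
  return (if L₁.num - (if L₁.num < R₁.num then L₁.num else R₁.num) = 0 then l + B else l,
    if R₁.num - (if L₁.num < R₁.num then L₁.num else R₁.num) = 0 then e - B else e,
    L₁.drop (if L₁.num < R₁.num then L₁.num else R₁.num),
    R₁.drop (if L₁.num < R₁.num then L₁.num else R₁.num))

/-- Isolating a single pass allows correctness and mispredictions to be treated separately by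
induction on the length of the interval. -/
theorem blockMainLoop_eq (B : ℕ+) (p l e : ℕ) (L R : Buffer) :
    blockMainLoop B p l e L R =
      if 2 * (B : ℕ) < e - l then
        blockPass B p l e L R >>= fun x => blockMainLoop B p x.1 x.2.1 x.2.2.1 x.2.2.2
      else do
        mispredict
        return (l, e, L, R) := by
  rw [blockMainLoop]
  unfold blockPass
  split_ifs <;> rfl

theorem blockPass_triple {B : ℕ+} {p l₀ e₀ l e : ℕ} {L R : Buffer} (hl : l₀ ≤ l) (he : e ≤ e₀)
    (hB : 2 * (B : ℕ) < e - l) :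
    Triple p l₀ e₀ (LoopInvariant B p l₀ e₀ l e L R) (blockPass B p l e L R) fun x m =>
      (l ≤ x.1 ∧ x.1 ≤ x.2.1 ∧ x.2.1 ≤ e ∧ x.2.1 - x.1 + B ≤ e - l) ∧
        LoopInvariant B p l₀ e₀ x.1 x.2.1 x.2.2.1 x.2.2.2 m := by
  have hB₀ := B.pos
  refine .bind .branch fun _ => ?_
  refine .bind (Q := fun L₁ m => L₁.Lists (l + ·) B (p < ·) m ∧ Outside p l₀ e₀ l e m ∧
    (R.num ≠ 0 → R.Lists (e - 1 - ·) B (· < p) m)) ?_ fun L₁ => ?_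
  · split_ifs with h
    · exact (scanLeft_triple hl (by omega)).post fun _ m _ h =>
        ⟨h.2, h.1.1, fun h' => (h.1.2.2.2 h').2⟩
    · exact .pure fun m _ h' => ⟨(h'.2.2.1 h).2, h'.1, fun h => (h'.2.2.2 h).2⟩
  refine .bind .branch fun _ => ?_
  refine .bind (Q := fun R₁ => Scanned p l₀ e₀ l e B B L₁ R₁) ?_ fun R₁ => ?_
  · split_ifs with h
    · exact (scanRight_triple (by omega) he).post fun _ m _ h => ⟨h.1.2.1, h.1.1, h.2⟩
    · exact .pure fun m _ h' => ⟨h'.2.1, h'.1, h'.2.2 h⟩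
  refine .bind .branch fun _ => ?_
  generalize hk : (if L₁.num < R₁.num then L₁.num else R₁.num) = k
  have hkL : k ≤ L₁.num := by split_ifs at hk <;> omega
  have hkR : k ≤ R₁.num := by split_ifs at hk <;> omega
  -- The minimum exhausts a buffer. This restores the invariant that at most one buffer is nonempty,
  -- and it makes a pointer advance.
  have hk₀ : L₁.num - k = 0 ∨ R₁.num - k = 0 := by split_ifs at hk <;> omega
  refine .bind (swapPairs_triple hl (by omega) he hkL hkR) fun _ => ?_
  refine .bind .branch fun _ => .bind .branch fun _ => .pure ?_
  rintro m hm ⟨hO, hL, hR⟩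
  refine ⟨⟨?_, ?_, ?_, ?_⟩, ?_, hk₀, fun h => ?_, fun h => ?_⟩
  · dsimp only; split_ifs <;> omega
  · dsimp only; split_ifs <;> omega
  · dsimp only; split_ifs <;> omega
  · dsimp only; split_ifs <;> omega
  · dsimp only
    split_ifs with h₁ h₂ h₂
    · exact (hO.advance_left hm (by omega) hL h₁).advance_right hm (by omega) hR h₂
    · exact hO.advance_left hm (by omega) hL h₁
    · exact hO.advance_right hm (by omega) hR h₂
    · exact hO
  · have h' : L₁.num - k ≠ 0 := h
    dsimp only
    simp only [h', if_false]
    exact ⟨by split_ifs <;> omega, hL⟩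
  · have h' : R₁.num - k ≠ 0 := h
    dsimp only
    simp only [h', if_false]
    exact ⟨by split_ifs <;> omega, hR⟩

theorem blockMainLoop_triple {B : ℕ+} {p l₀ e₀ : ℕ} (l e : ℕ) (L R : Buffer) (hl : l₀ ≤ l)
    (hle : l ≤ e) (he : e ≤ e₀) :
    Triple p l₀ e₀ (LoopInvariant B p l₀ e₀ l e L R) (blockMainLoop B p l e L R) fun x m =>
      (l₀ ≤ x.1 ∧ x.1 ≤ x.2.1 ∧ x.2.1 ≤ e₀) ∧
        LoopInvariant B p l₀ e₀ x.1 x.2.1 x.2.2.1 x.2.2.2 m := by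
  induction h : e - l using Nat.strong_induction_on generalizing l e L R with
  | _ n ih =>
  rw [blockMainLoop_eq]
  have hB₀ := B.pos
  split_ifs with hB
  · refine .bind (blockPass_triple hl he hB) fun x => .assume fun hx => ?_
    exact ih _ (by omega) _ _ _ _ (by omega) (by omega) (by omega) rfl
  · exact .bind .mispredict fun _ => .pure fun m _ h => ⟨by dsimp only; omega, h⟩

theorem finalScan_triple {B : ℕ+} {p l₀ e₀ l e : ℕ} {L R : Buffer} (hl : l₀ ≤ l)
    (hle : l ≤ e) (he : e ≤ e₀) :
    Triple p l₀ e₀ (LoopInvariant B p l₀ e₀ l e L R) (finalScan B p l e L R) fun x m =>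
      x.2.2.1 + x.2.2.2 = e - l ∧ Scanned p l₀ e₀ l e x.2.2.1 x.2.2.2 x.1 x.2.1 m := by
  refine .bind .branch fun _ => ?_
  by_cases h₀ : R.num = 0 ∧ L.num = 0
  · rw [if_pos h₀]
    refine .bind (Q := fun x m => (Outside p l₀ e₀ l e m ∧ x.1.start = 0 ∧
      x.1.Lists (l + ·) ((e - l) / 2) (p < ·) m) ∧ x.2.start = 0 ∧
      x.2.Lists (e - 1 - ·) ((e - l) / 2) (· < p) m) ?_ fun x => ?_
    · refine .pre (.forLoop (I := fun j (x : Buffer × Buffer) m => (Outside p l₀ e₀ l e m ∧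
        x.1.start = 0 ∧ x.1.Lists (l + ·) j (p < ·) m) ∧ x.2.start = 0 ∧
        x.2.Lists (e - 1 - ·) j (· < p) m) ?_) ?_
      · intro j hj x
        refine .bind (Q := fun b m => (Outside p l₀ e₀ l e m ∧ x.2.start = 0 ∧
            x.2.Lists (e - 1 - ·) j (· < p) m) ∧ b.start = 0 ∧
            b.Lists (l + ·) (j + 1) (p < ·) m) ?_ fun b => ?_
        · exact (scanStepLeft_triple hl (by omega)).pre fun m _ h => ⟨⟨h.1.1, h.2⟩, h.1.2⟩
        · refine .bind (Q := fun b' m => (Outside p l₀ e₀ l e m ∧ b.start = 0 ∧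
            b.Lists (l + ·) (j + 1) (p < ·) m) ∧ b'.start = 0 ∧
            b'.Lists (e - 1 - ·) (j + 1) (· < p) m) ?_ fun b' => .pure fun m _ h => h
          exact (scanStepRight_triple (by omega) he).pre fun m _ h => ⟨⟨h.1.1, h.2⟩, h.1.2⟩
      · exact fun m _ h => ⟨⟨h.1, rfl, .empty⟩, rfl, .empty⟩
    · obtain ⟨L₁, R₁⟩ := x
      refine .bind .branch fun _ => ?_
      dsimp only
      split_ifs with h₁
      · refine .bind (Q := fun R₂ m => (Outside p l₀ e₀ l e m ∧ L₁.start = 0 ∧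
          L₁.Lists (l + ·) ((e - l) / 2) (p < ·) m) ∧ R₂.start = 0 ∧
          R₂.Lists (e - 1 - ·) (e - l - (e - l) / 2) (· < p) m) ?_
          fun R₂ => .pure fun m _ h => ⟨by dsimp only; omega, h.1.1, h.1.2.2, h.2.2⟩
        -- The length is odd here: the right block has one element more, whose offset is `(e - l) /
        -- 2`.
        have h₂ : e - l - (e - l) / 2 - 1 = (e - l) / 2 := by omega
        have h₃ : e - l - (e - l) / 2 = (e - l) / 2 + 1 := by omega
        rw [h₂, h₃]
        exact scanStepRight_triple (by omega) he
      · refine .pure fun m _ h => ⟨by dsimp only; omega, h.1.1, h.1.2.2, ?_⟩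
        have h₃ : e - l - (e - l) / 2 = (e - l) / 2 := by omega
        dsimp only
        rw [h₃]
        exact h.2.2
  · rw [if_neg h₀]
    refine .bind .branch fun _ => ?_
    split_ifs with hR
    · refine .pre (.assume (φ := l + B ≤ e) fun hB => ?_) fun m _ h => ⟨(h.2.2.2 hR).1, h⟩
      refine Triple.bind (scanLeft_triple (n := e - l - B) hl (by omega)) fun L₁ => .pure ?_
      exact fun m _ h => ⟨by dsimp only; omega, h.1.1, h.2, (h.1.2.2.2 hR).2⟩
    · have hL : L.num ≠ 0 := by omega
      refine .pre (.assume (φ := l + B ≤ e) fun hB => ?_) fun m _ h => ⟨(h.2.2.1 hL).1, h⟩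
      refine Triple.bind (scanRight_triple (n := e - l - B) (by omega) he) fun L₁ => .pure ?_
      exact fun m _ h => ⟨by dsimp only; omega, h.1.1, (h.1.2.2.1 hL).2, h.2⟩

theorem skipPlaced_snd_le (b : Buffer) (t u : ℕ) : (skipPlaced b t u).2 ≤ u := by
  induction t generalizing u with
  | zero => exact le_rfl
  | succ t ih =>
    rw [skipPlaced]
    split_ifs
    · exact (ih _).trans (Nat.sub_le _ _)
    · exact le_rfl

theorem skipPlaced_lists {b : Buffer} {pos : ℕ → ℕ} {bad : ℕ → Prop} {m : ℕ → ℕ} (t u : ℕ)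
    (h : Buffer.Lists ⟨b.offsets, b.start, t⟩ pos u bad m) :
    Buffer.Lists ⟨b.offsets, b.start, (skipPlaced b t u).1⟩ pos (skipPlaced b t u).2 bad m ∧
      ∀ i, (skipPlaced b t u).2 ≤ i → i < u → bad (m (pos i)) := by
  induction t generalizing u with
  | zero => exact ⟨h, fun i h₁ h₂ => by simp only [skipPlaced] at h₁; omega⟩
  | succ t ih =>
    rw [skipPlaced]
    split_ifs with hu
    · obtain ⟨h₁, h₂⟩ := h.drop_last hu
      refine ⟨(ih _ h₁).1, fun i hi hi' => ?_⟩
      by_cases hiu : i < u - 1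
      · exact (ih _ h₁).2 i hi hiu
      · obtain rfl : i = u - 1 := by omega
        exact h₂
    · exact ⟨h, fun i h₁ h₂ => by omega⟩

/-- Each exchange settles one large key at the place `u - 1` and lowers the boundary `u`. When no
entries are left, the list is empty and everything below the boundary is small. -/
theorem moveRight_triple {p l₀ e₀ l : ℕ} {b : Buffer} (t u : ℕ) (hl : l₀ ≤ l) (hu : l + u ≤ e₀) :
    Triple p l₀ e₀ (fun m => Outside p l₀ e₀ l (l + u) m ∧
        Buffer.Lists ⟨b.offsets, b.start, t⟩ (l + ·) u (p < ·) m)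
      (moveRight l b t u) fun _ => Partitioned p l₀ e₀ (l + (u - t)) := by
  induction t generalizing u with
  | zero =>
    refine Triple.mispredict.post fun _ m hm h => ⟨by omega, ?_⟩
    exact h.1.advance_left hm hu h.2 rfl
  | succ t ih =>
    intro m hm h
    have ht : b.offsets (b.start + t) < u := h.2.offset_lt (j := t) (Nat.lt_succ_self t)
    refine Triple.bind (P := fun m => Outside p l₀ e₀ l (l + u) m ∧
        Buffer.Lists ⟨b.offsets, b.start, t + 1⟩ (l + ·) u (p < ·) m)
      (Q := fun _ m => Outside p l₀ e₀ l (l + (u - 1)) m ∧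
        Buffer.Lists ⟨b.offsets, b.start, t⟩ (l + ·) (u - 1) (p < ·) m)
      (.swapAt (by omega) (by omega) ?_)
      (fun _ => by
        rw [show u - (t + 1) = u - 1 - t by omega]
        exact ih (u - 1) (by omega)) m hm h
    rintro m - ⟨hO, hb⟩
    obtain ⟨h₁, h₂⟩ := hb.swap_last (fun i _ i' _ h => by omega)
    have hO' := hO.swap (i := l + (u - 1)) (j := l + b.offsets (b.start + t)) (by omega) (by omega)
    refine ⟨⟨hO'.1, fun i hi hi' => ?_⟩, h₁⟩
    rcases hi.eq_or_lt with rfl | hi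
    · exact h₂
    · exact hO'.2 i (by omega) hi'

theorem moveLeft_triple {p l₀ e₀ e : ℕ} {b : Buffer} (t u : ℕ) (he : e ≤ e₀) (hu : l₀ + u ≤ e) :
    Triple p l₀ e₀ (fun m => Outside p l₀ e₀ (e - u) e m ∧
        Buffer.Lists ⟨b.offsets, b.start, t⟩ (e - 1 - ·) u (· < p) m)
      (moveLeft e b t u) fun _ => Partitioned p l₀ e₀ (e - (u - t)) := by
  induction t generalizing u with
  | zero =>
    refine Triple.mispredict.post fun _ m hm h => ⟨by omega, ?_⟩
    exact h.1.advance_right hm hu h.2 rfl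
  | succ t ih =>
    intro m hm h
    have ht : b.offsets (b.start + t) < u := h.2.offset_lt (j := t) (Nat.lt_succ_self t)
    refine Triple.bind (P := fun m => Outside p l₀ e₀ (e - u) e m ∧
        Buffer.Lists ⟨b.offsets, b.start, t + 1⟩ (e - 1 - ·) u (· < p) m)
      (Q := fun _ m => Outside p l₀ e₀ (e - (u - 1)) e m ∧
        Buffer.Lists ⟨b.offsets, b.start, t⟩ (e - 1 - ·) (u - 1) (· < p) m)
      (.swapAt (by omega) (by omega) ?_)
      (fun _ => by
        rw [show u - (t + 1) = u - 1 - t by omega]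
        exact ih (u - 1) (by omega)) m hm h
    rintro m - ⟨hO, hb⟩
    obtain ⟨h₁, h₂⟩ := hb.swap_last (fun i _ i' _ h => by omega)
    have hO' := hO.swap (i := e - 1 - (u - 1)) (j := e - 1 - b.offsets (b.start + t))
      (by omega) (by omega)
    refine ⟨⟨fun i hi hi' => ?_, hO'.2⟩, h₁⟩
    by_cases hiu : i < e - u
    · exact hO'.1 i hi hiu
    · obtain rfl : i = e - 1 - (u - 1) := by omega
      exact h₂

/-- By now the block of an exhausted buffer has been passed over, so the interval is exactly the
block of the other buffer, and it is empty if both are exhausted. Hence the full length `e - l` in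
the lists and the hypothesis `h₀`. -/
theorem finalMove_triple {p l₀ e₀ l e : ℕ} {L R : Buffer} (hl : l₀ ≤ l) (hle : l ≤ e)
    (he : e ≤ e₀) (h₀ : L.num = 0 → R.num = 0 → l = e) :
    Triple p l₀ e₀ (fun m => Outside p l₀ e₀ l e m ∧
        (L.num ≠ 0 → L.Lists (l + ·) (e - l) (p < ·) m) ∧
        (R.num ≠ 0 → R.Lists (e - 1 - ·) (e - l) (· < p) m))
      (finalMove l e L R) (Partitioned p l₀ e₀) := by
  refine .bind .branch fun _ => ?_
  by_cases hL : L.num ≠ 0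
  · rw [if_pos hL]
    have hu := skipPlaced_snd_le L L.num (e - l)
    refine .pre (P' := fun m => Outside p l₀ e₀ l (l + (skipPlaced L L.num (e - l)).2) m ∧
      Buffer.Lists ⟨L.offsets, L.start, (skipPlaced L L.num (e - l)).1⟩ (l + ·)
        (skipPlaced L L.num (e - l)).2 (p < ·) m) ?_ ?_
    · refine .bind .mispredict fun _ => ?_
      refine .bind (moveRight_triple _ _ hl (by omega)) fun _ => .pure fun m _ h => h
    · rintro m - ⟨hO, h, -⟩
      obtain ⟨h₁, h₂⟩ := skipPlaced_lists L.num (e - l) (h hL)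
      refine ⟨⟨hO.1, fun i hi hi' => ?_⟩, h₁⟩
      by_cases hie : i < e
      · have := h₂ (i - l) (by omega) (by omega)
        simpa only [show l + (i - l) = i by omega] using this
      · exact hO.2 i (by omega) hi'
  · rw [if_neg hL]
    refine .bind .branch fun _ => ?_
    split_ifs with hR
    · have hu := skipPlaced_snd_le R R.num (e - l)
      refine .pre (P' := fun m => Outside p l₀ e₀ (e - (skipPlaced R R.num (e - l)).2) e m ∧
        Buffer.Lists ⟨R.offsets, R.start, (skipPlaced R R.num (e - l)).1⟩ (e - 1 - ·)
          (skipPlaced R R.num (e - l)).2 (· < p) m) ?_ ?_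
      · refine .bind .mispredict fun _ => ?_
        refine .bind (moveLeft_triple _ _ he (by omega)) fun _ => .pure fun m _ h => h
      · rintro m - ⟨hO, -, h⟩
        obtain ⟨h₁, h₂⟩ := skipPlaced_lists R.num (e - l) (h hR)
        refine ⟨⟨fun i hi hi' => ?_, hO.2⟩, h₁⟩
        by_cases hil : l ≤ i
        · have := h₂ (e - 1 - i) (by omega) (by omega)
          simpa only [show e - 1 - (e - 1 - i) = i by omega] using this
        · exact hO.1 i hi (by omega)
    · refine .pure fun m _ h => ?_
      have := h₀ (by omega) (by omega)
      exact ⟨by omega, h.1.1, fun i hi hi' => h.1.2 i (by omega) hi'⟩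

theorem isPartitioner_blockPartition (B : ℕ+) : IsPartitioner (blockPartition B) := by
  intro p l e hle
  refine .bind (Q := fun x m => (l ≤ x.1 ∧ x.1 ≤ x.2.1 ∧ x.2.1 ≤ e) ∧
    LoopInvariant B p l e x.1 x.2.1 x.2.2.1 x.2.2.2 m) ?_ ?_
  · refine (blockMainLoop_triple l e _ _ le_rfl hle le_rfl).pre fun m _ _ => ?_
    exact ⟨⟨fun _ _ _ => by omega, fun _ _ _ => by omega⟩, .inl rfl, fun h => absurd rfl h,
      fun h => absurd rfl h⟩
  rintro ⟨l₁, e₁, L, R⟩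
  refine .assume fun hx => ?_
  dsimp only at hx ⊢
  refine .bind (finalScan_triple hx.1 hx.2.1 hx.2.2) ?_
  rintro ⟨L₁, R₁, sL, sR⟩
  refine .assume fun hs => ?_
  dsimp only at hs ⊢
  refine .bind .branch fun _ => ?_
  generalize hk : (if L₁.num < R₁.num then L₁.num else R₁.num) = k
  have hkL : k ≤ L₁.num := by split_ifs at hk <;> omega
  have hkR : k ≤ R₁.num := by split_ifs at hk <;> omega
  have hk₀ : L₁.num - k = 0 ∨ R₁.num - k = 0 := by split_ifs at hk <;> omega
  refine .bind (swapPairs_triple hx.1 (by omega) hx.2.2 hkL hkR) fun _ => ?_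
  refine .bind .branch fun _ => .bind .branch fun _ => ?_
  have hdL : (L₁.drop k).num = L₁.num - k := rfl
  have hdR : (R₁.drop k).num = R₁.num - k := rfl
  refine .pre (finalMove_triple ?_ ?_ ?_ ?_) ?_
  · split_ifs <;> omega
  · split_ifs <;> omega
  · split_ifs <;> omega
  · rw [hdL, hdR]
    split_ifs <;> omega
  · rw [hdL, hdR]
    rintro m hm ⟨hO, hL, hR⟩
    refine ⟨?_, fun h => ?_, fun h => ?_⟩
    · split_ifs with h₁ h₂ h₂
      · exact (hO.advance_left hm (by omega) hL h₁).advance_right hm (by omega) hR h₂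
      · exact hO.advance_left hm (by omega) hL h₁
      · exact hO.advance_right hm (by omega) hR h₂
      · exact hO
    -- A nonempty left buffer means that the right one is exhausted; without the right block the
    -- interval has length `sL`.
    · rw [if_neg h, if_pos (by omega), show e₁ - sR - l₁ = sL by omega]
      exact hL
    · rw [if_neg h, if_pos (by omega), show e₁ - (l₁ + sL) = sR by omega]
      exact hR

/-! ### Bounds for the counters -/

/-- The program increases the counter `κ` by an amount that satisfies `Q`, whatever the array. -/
def Counts {α : Type} (κ : Machine → ℕ) (x : Prog α) (Q : α → ℕ → Prop) : Prop :=
  ∀ s, ∃ d, κ (x.run s).2 = κ s + d ∧ Q (x.run s).1 d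

namespace Counts

variable {α β σ : Type} {κ : Machine → ℕ}

theorem pure {r : α} {Q : α → ℕ → Prop} (h : Q r 0) : Counts κ (pure r) Q :=
  fun _ => ⟨0, rfl, h⟩

theorem bind {x : Prog α} {f : α → Prog β} {Q : α → ℕ → Prop} {R : β → ℕ → Prop}
    (hx : Counts κ x Q) (hf : ∀ r d, Q r d → Counts κ (f r) fun r' d' => R r' (d + d')) :
    Counts κ (x >>= f) R := by
  intro s
  obtain ⟨d, hd, hQ⟩ := hx s
  obtain ⟨d', hd', hR⟩ := hf _ d hQ (x.run s).2
  refine ⟨d + d', ?_, hR⟩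
  have hrun : (x >>= f).run s = (f (x.run s).1).run (x.run s).2 := rfl
  rw [hrun, hd', hd, add_assoc]

theorem post {x : Prog α} {Q R : α → ℕ → Prop} (hx : Counts κ x Q) (h : ∀ r d, Q r d → R r d) :
    Counts κ x R := fun s => by
  obtain ⟨d, hd, hQ⟩ := hx s
  exact ⟨d, hd, h _ _ hQ⟩

theorem repeatBody {n c : ℕ} {body : ℕ → σ → Prog σ} {t : σ}
    (h : ∀ j t, Counts κ (body j t) fun _ d => d ≤ c) :
    Counts κ (repeatBody n body t) fun _ d => d ≤ n * c := by
  induction n with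
  | zero => exact pure (by omega)
  | succ n ih =>
    exact bind ih fun r d hd => (h n r).post fun _ d' hd' => by rw [Nat.succ_mul]; omega

theorem mispredictions_mispredict : Counts Machine.mispredictions mispredict fun _ d => d = 1 :=
  fun _ => ⟨1, rfl, rfl⟩

theorem mispredictions_branch {c : Prop} [Decidable c] :
    Counts Machine.mispredictions (branch c) fun _ d => d = if c then 0 else 1 := by
  unfold BlockQuicksort.branch
  split_ifs
  · exact pure rfl
  · exact mispredictions_mispredict

theorem mispredictions_branch_le {c : Prop} [Decidable c] :
    Counts Machine.mispredictions (branch c) fun _ d => d ≤ 1 :=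
  mispredictions_branch.post fun _ d hd => by split_ifs at hd <;> omega

theorem mispredictions_forLoop {n c : ℕ} {body : ℕ → σ → Prog σ} {t : σ}
    (h : ∀ j t, Counts Machine.mispredictions (body j t) fun _ d => d ≤ c) :
    Counts Machine.mispredictions (forLoop n body t) fun _ d => d ≤ n * c + 1 :=
  bind (repeatBody h) fun _ _ hd => bind mispredictions_mispredict fun _ _ hd' => pure (by omega)

theorem mispredictions_swapAt {i j : ℕ} : Counts Machine.mispredictions (swapAt i j) fun _ d => d = 0 :=
  fun _ => ⟨0, rfl, rfl⟩

theorem mispredictions_readAt {i : ℕ} : Counts Machine.mispredictions (readAt i) fun _ d => d = 0 :=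
  fun _ => ⟨0, rfl, rfl⟩

theorem mispredictions_less {x y : ℕ} : Counts Machine.mispredictions (less x y) fun _ d => d = 0 :=
  fun _ => ⟨0, rfl, rfl⟩

theorem comparisons_less {x y : ℕ} : Counts Machine.comparisons (less x y)
    fun _ d => d = 1 :=
  fun _ => ⟨1, rfl, rfl⟩

theorem comparisons_readAt {i : ℕ} : Counts Machine.comparisons (readAt i)
    fun _ d => d = 0 :=
  fun _ => ⟨0, rfl, rfl⟩

theorem comparisons_swapAt {i j : ℕ} : Counts Machine.comparisons (swapAt i j)
    fun _ d => d = 0 :=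
  fun _ => ⟨0, rfl, rfl⟩

theorem comparisons_mispredict : Counts Machine.comparisons mispredict
    fun _ d => d = 0 :=
  fun _ => ⟨0, rfl, rfl⟩

theorem comparisons_branch {c : Prop} [Decidable c] :
    Counts Machine.comparisons (branch c) fun _ d => d = 0 := by
  unfold BlockQuicksort.branch
  split_ifs
  · exact pure rfl
  · exact comparisons_mispredict

end Counts


/-! ### Mispredictions and comparisons of the single procedures -/

theorem scanStepLeft_mispredictions {p l i : ℕ} {b : Buffer} :
    Counts Machine.mispredictions (scanStepLeft p l i b) fun _ d => d ≤ 0 :=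
  .bind .mispredictions_readAt fun _ _ _ => .bind .mispredictions_less fun _ _ _ => .pure (by omega)

theorem scanStepRight_mispredictions {p e i : ℕ} {b : Buffer} :
    Counts Machine.mispredictions (scanStepRight p e i b) fun _ d => d ≤ 0 :=
  .bind .mispredictions_readAt fun _ _ _ => .bind .mispredictions_less fun _ _ _ => .pure (by omega)

theorem scanLeft_mispredictions {p l n : ℕ} :
    Counts Machine.mispredictions (scanLeft p l n) fun _ d => d ≤ 1 :=
  (Counts.mispredictions_forLoop fun j t => scanStepLeft_mispredictions).post fun _ _ h => by omega

theorem scanRight_mispredictions {p e n : ℕ} :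
    Counts Machine.mispredictions (scanRight p e n) fun _ d => d ≤ 1 :=
  (Counts.mispredictions_forLoop fun j t => scanStepRight_mispredictions).post fun _ _ h => by omega

theorem swapPairs_mispredictions {l e : ℕ} {L R : Buffer} {k : ℕ} :
    Counts Machine.mispredictions (swapPairs l e L R k) fun _ d => d ≤ 1 :=
  (Counts.mispredictions_forLoop (c := 0) fun _ _ => Counts.mispredictions_swapAt.post fun _ _ h => by omega).post fun _ _ h => by omega

theorem blockPass_mispredictions {B : ℕ+} {p l e : ℕ} {L R : Buffer} (hB : 2 * (B : ℕ) < e - l) :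
    Counts Machine.mispredictions (blockPass B p l e L R) fun x d =>
      d ≤ 5 ∧ x.2.1 - x.1 + B ≤ e - l := by
  -- The test and the scan together cost one: a successful test leads to one exit from the scanning
  -- loop, a failed one avoids the loop.
  have hL : Counts Machine.mispredictions (branch (L.num = 0) >>= fun _ =>
      if L.num = 0 then scanLeft p l B else pure L) fun _ d => d ≤ 1 := by
    refine .bind .mispredictions_branch fun _ d hd => ?_
    split_ifs at hd ⊢
    · exact (scanLeft_mispredictions).post fun _ _ h => by omega
    · exact .pure (by omega)
  have hR : Counts Machine.mispredictions (branch (R.num = 0) >>= fun _ =>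
      if R.num = 0 then scanRight p e B else pure R) fun _ d => d ≤ 1 := by
    refine .bind .mispredictions_branch fun _ d hd => ?_
    split_ifs at hd ⊢
    · exact (scanRight_mispredictions).post fun _ _ h => by omega
    · exact .pure (by omega)
  have hpass : blockPass B p l e L R = ((branch (L.num = 0) >>= fun _ =>
      if L.num = 0 then scanLeft p l B else pure L) >>= fun L₁ => (branch (R.num = 0) >>= fun _ =>
      if R.num = 0 then scanRight p e B else pure R) >>= fun R₁ => do
        branch (L₁.num < R₁.num)
        swapPairs l e L₁ R₁ (if L₁.num < R₁.num then L₁.num else R₁.num)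
        branch (L₁.num - (if L₁.num < R₁.num then L₁.num else R₁.num) = 0)
        branch (R₁.num - (if L₁.num < R₁.num then L₁.num else R₁.num) = 0)
        return (if L₁.num - (if L₁.num < R₁.num then L₁.num else R₁.num) = 0 then l + B else l,
          if R₁.num - (if L₁.num < R₁.num then L₁.num else R₁.num) = 0 then e - B else e,
          L₁.drop (if L₁.num < R₁.num then L₁.num else R₁.num),
          R₁.drop (if L₁.num < R₁.num then L₁.num else R₁.num))) := rfl
  rw [hpass]
  refine .bind hL fun L₁ d₁ h₁ => .bind hR fun R₁ d₂ h₂ => ?_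
  refine .bind .mispredictions_branch_le fun _ d₃ h₃ => .bind (swapPairs_mispredictions) fun _ d₄ h₄ => ?_
  generalize hk : (if L₁.num < R₁.num then L₁.num else R₁.num) = k
  -- At most one of the last two tests fails, which gives 5 rather than 6, and at least one pointer
  -- advances by `B`.
  have hk₀ : L₁.num - k = 0 ∨ R₁.num - k = 0 := by split_ifs at hk <;> omega
  refine .bind .mispredictions_branch fun _ d₅ h₅ => .bind .mispredictions_branch fun _ d₆ h₆ => .pure ⟨?_, ?_⟩
  · split_ifs at h₅ h₆ <;> omega
  · dsimp only
    split_ifs <;> omega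

/-- Five mispredictions are charged to the at least `B` elements that a pass consumes; the summand
`B` pays for leaving the loop. Multiplication by `B` avoids division. -/
theorem blockMainLoop_mispredictions {B : ℕ+} {p l e : ℕ} {L R : Buffer} :
    Counts Machine.mispredictions (blockMainLoop B p l e L R) fun _ d =>
      B * d ≤ 5 * (e - l) + B := by
  induction h : e - l using Nat.strong_induction_on generalizing l e L R with
  | _ n ih =>
  rw [blockMainLoop_eq]
  have hB₀ := B.pos
  subst h
  split_ifs with hB
  · refine .bind (blockPass_mispredictions hB) fun x d hd => ?_
    refine (ih _ (by omega) rfl).post fun _ d' hd' => ?_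
    have : (B : ℕ) * d ≤ B * 5 := Nat.mul_le_mul_left _ hd.1
    rw [mul_add]
    omega
  · exact .bind .mispredictions_mispredict fun _ d hd => .pure (by subst hd; omega)

theorem finalScan_mispredictions {B : ℕ+} {p l e : ℕ} {L R : Buffer} :
    Counts Machine.mispredictions (finalScan B p l e L R) fun _ d => d ≤ 3 := by
  refine .bind .mispredictions_branch_le fun _ d₁ h₁ => ?_
  by_cases h₀ : R.num = 0 ∧ L.num = 0
  · rw [if_pos h₀]
    refine .bind (Counts.mispredictions_forLoop (c := 0) fun j b => .bind (scanStepLeft_mispredictions) fun _ _ _ =>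
      .bind (scanStepRight_mispredictions) fun _ _ _ => .pure (by omega)) ?_
    rintro ⟨L₁, R₁⟩ d₂ h₂
    refine .bind .mispredictions_branch_le fun _ d₃ h₃ => ?_
    dsimp only
    split_ifs
    · exact .bind (scanStepRight_mispredictions) fun _ _ _ => .pure (by omega)
    · exact .pure (by omega)
  · rw [if_neg h₀]
    refine .bind .mispredictions_branch_le fun _ d₂ h₂ => ?_
    split_ifs
    · exact .bind (scanLeft_mispredictions) fun _ _ _ => .pure (by omega)
    · exact .bind (scanRight_mispredictions) fun _ _ _ => .pure (by omega)

theorem moveRight_mispredictions {l : ℕ} {b : Buffer} {t u : ℕ} :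
    Counts Machine.mispredictions (moveRight l b t u) fun _ d => d ≤ 1 := by
  induction t generalizing u with
  | zero => exact Counts.mispredictions_mispredict.post fun _ _ h => by omega
  | succ t ih => exact .bind .mispredictions_swapAt fun _ _ _ => ih.post fun _ _ _ => by omega

theorem moveLeft_mispredictions {e : ℕ} {b : Buffer} {t u : ℕ} :
    Counts Machine.mispredictions (moveLeft e b t u) fun _ d => d ≤ 1 := by
  induction t generalizing u with
  | zero => exact Counts.mispredictions_mispredict.post fun _ _ h => by omega
  | succ t ih => exact .bind .mispredictions_swapAt fun _ _ _ => ih.post fun _ _ _ => by omega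

theorem finalMove_mispredictions {l e : ℕ} {L R : Buffer} :
    Counts Machine.mispredictions (finalMove l e L R) fun _ d => d ≤ 4 := by
  refine .bind .mispredictions_branch_le fun _ d₁ h₁ => ?_
  by_cases hL : L.num ≠ 0
  · rw [if_pos hL]
    exact .bind .mispredictions_mispredict fun _ _ _ => .bind (moveRight_mispredictions) fun _ _ _ =>
      .pure (by omega)
  · rw [if_neg hL]
    refine .bind .mispredictions_branch_le fun _ d₂ h₂ => ?_
    split_ifs
    · exact .bind .mispredictions_mispredict fun _ _ _ => .bind (moveLeft_mispredictions) fun _ _ _ =>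
        .pure (by omega)
    · exact .pure (by omega)

theorem blockPartition_mispredictions {B : ℕ+} {p l e : ℕ} :
    Counts Machine.mispredictions (blockPartition B p l e) fun _ d =>
      B * d ≤ 5 * (e - l) + B * 12 := by
  refine .bind (blockMainLoop_mispredictions) ?_
  rintro ⟨l₁, e₁, L, R⟩ d₁ h₁
  refine .bind (finalScan_mispredictions) ?_
  rintro ⟨L₁, R₁, sL, sR⟩ d₂ h₂
  refine .bind .mispredictions_branch_le fun _ d₃ h₃ => .bind (swapPairs_mispredictions) fun _ d₄ h₄ => ?_
  refine .bind .mispredictions_branch_le fun _ d₅ h₅ => .bind .mispredictions_branch_le fun _ d₆ h₆ => ?_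
  refine finalMove_mispredictions.post fun _ d₇ h₇ => ?_
  -- Here 11 = 3 + 1 + 1 + 1 + 1 + 4; the twelfth misprediction is the exit from the main loop,
  -- contained in `h₁`.
  have : (B : ℕ) * (d₂ + (d₃ + (d₄ + (d₅ + (d₆ + d₇))))) ≤ B * 11 :=
    Nat.mul_le_mul_left _ (by omega)
  rw [mul_add]
  omega

theorem PivotTree.run_mispredictions (t : PivotTree) :
    Counts Machine.mispredictions t.run fun _ d => d ≤ t.depth := by
  induction t with
  | take i => exact .pure (by omega)
  | test i j t f iht ihf =>
    refine .bind .mispredictions_readAt fun _ _ _ => .bind .mispredictions_readAt fun _ _ _ => .bind .mispredictions_less fun c _ _ => ?_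
    refine .bind .mispredictions_branch_le fun _ _ _ => ?_
    simp only [PivotTree.depth]
    split_ifs
    · exact iht.post fun _ _ _ => by omega
    · exact ihf.post fun _ _ _ => by omega

/-- For a lower bound on the comparisons it suffices that the counter does not decrease, which is
already part of `Counts`. -/
theorem PivotTree.run_comparisons (t : PivotTree) :
    Counts Machine.comparisons t.run fun _ _ => True := by
  induction t with
  | take i => exact .pure trivial
  | test i j t f iht ihf =>
    refine .bind .comparisons_readAt fun _ _ _ => .bind .comparisons_readAt fun _ _ _ =>
      .bind .comparisons_less fun c _ _ => ?_
    refine .bind .comparisons_branch fun _ _ _ => ?_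
    split_ifs
    · exact iht
    · exact ihf

theorem insertElement_mispredictions {l j : ℕ} :
    Counts Machine.mispredictions (insertElement l j) fun _ d => d ≤ 1 := by
  induction j with
  | zero => exact Counts.mispredictions_mispredict.post fun _ _ h => by omega
  | succ j ih =>
    rw [insertElement]
    split_ifs
    · refine .bind .mispredictions_readAt fun _ _ _ => .bind .mispredictions_readAt fun _ _ _ => .bind .mispredictions_less fun c _ _ => ?_
      split_ifs
      · exact .bind .mispredictions_swapAt fun _ _ _ => ih.post fun _ _ _ => by omega
      · exact Counts.mispredictions_mispredict.post fun _ _ h => by omega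
    · exact Counts.mispredictions_mispredict.post fun _ _ h => by omega

theorem insertElement_comparisons {l j : ℕ} :
    Counts Machine.comparisons (insertElement l j) fun _ _ => True := by
  induction j with
  | zero => exact Counts.comparisons_mispredict.post fun _ _ h => trivial
  | succ j ih =>
    rw [insertElement]
    split_ifs
    · refine .bind .comparisons_readAt fun _ _ _ => .bind .comparisons_readAt fun _ _ _ =>
        .bind .comparisons_less fun c _ _ => ?_
      split_ifs
      · exact .bind .comparisons_swapAt fun _ _ _ => ih
      · exact Counts.comparisons_mispredict.post fun _ _ h => trivial
    · exact Counts.comparisons_mispredict.post fun _ _ h => trivial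

theorem insertionSort_mispredictions {l e : ℕ} :
    Counts Machine.mispredictions (insertionSort l e) fun _ d => d ≤ e - l - 1 + 1 :=
  (Counts.mispredictions_forLoop fun _ _ => insertElement_mispredictions).post fun _ _ _ => by omega

theorem insertionSort_comparisons {l e : ℕ} :
    Counts Machine.comparisons (insertionSort l e) fun _ _ => True := by
  refine .bind (Q := fun _ _ => True) ?_ fun _ _ _ => .bind .comparisons_mispredict fun _ _ _ =>
    .pure trivial
  induction e - l - 1 with
  | zero => exact .pure trivial
  | succ n ih => exact .bind ih fun _ _ _ => insertElement_comparisons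

theorem hoareScanLeft_comparisons {p l e : ℕ} (hle : l ≤ e) :
    Counts Machine.comparisons (hoareScanLeft p l e) fun a d =>
      l + a ≤ e ∧ a ≤ d ∧ (l + a < e → a + 1 ≤ d) := by
  induction h : e - l generalizing l with
  | zero =>
    rw [hoareScanLeft, if_neg (by omega)]
    exact .bind .comparisons_mispredict fun _ _ _ => .pure (by omega)
  | succ n ih =>
    rw [hoareScanLeft, if_pos (by omega)]
    refine .bind .comparisons_readAt fun _ _ _ => .bind .comparisons_less fun c _ _ => ?_
    split_ifs
    · exact .bind (ih (by omega) (by omega)) fun _ _ _ => .pure (by omega)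
    · exact .bind .comparisons_mispredict fun _ _ _ => .pure (by omega)

theorem hoareScanRight_comparisons {p l e : ℕ} (hle : l ≤ e) :
    Counts Machine.comparisons (hoareScanRight p l e) fun b d =>
      l + b ≤ e ∧ b ≤ d ∧ (l < e - b → b + 1 ≤ d) := by
  induction h : e - l generalizing e with
  | zero =>
    rw [hoareScanRight, if_neg (by omega)]
    exact .bind .comparisons_mispredict fun _ _ _ => .pure (by omega)
  | succ n ih =>
    rw [hoareScanRight, if_pos (by omega)]
    refine .bind .comparisons_readAt fun _ _ _ => .bind .comparisons_less fun c _ _ => ?_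
    split_ifs
    · exact .bind (ih (by omega) (by omega)) fun _ _ _ => .pure (by omega)
    · exact .bind .comparisons_mispredict fun _ _ _ => .pure (by omega)

/-- A scan that stops inside its range has also compared the element where it stops, so when the
scans meet no element has been missed. -/
theorem hoarePartition_comparisons {p l e : ℕ} :
    Counts Machine.comparisons (hoarePartition p l e) fun _ d => e - l ≤ d := by
  induction h : e - l using Nat.strong_induction_on generalizing l e with
  | _ n ih =>
  rw [hoarePartition]
  subst h
  split_ifs with hlt
  · refine .bind (hoareScanLeft_comparisons hlt.le) fun a d₁ h₁ => ?_
    refine .bind (hoareScanRight_comparisons h₁.1) fun b d₂ h₂ => ?_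
    refine .bind .comparisons_branch fun _ _ _ => ?_
    split_ifs with hab
    · refine .bind .comparisons_swapAt fun _ _ _ => ?_
      exact (ih _ (by omega) rfl).post fun _ _ _ => by omega
    · exact .bind .comparisons_mispredict fun _ _ _ => .pure (by omega)
  · exact .bind .comparisons_mispredict fun _ _ _ => .pure (by omega)

/-! ### One level of the recursion -/

/-- Selection of a pivot and partitioning of `[l, e)`, with the final position of the pivot as
result. -/
def divide (part : ℕ → ℕ → ℕ → Prog ℕ) (T : PivotMethod) (l e : ℕ) : Prog ℕ := do
  let q ← (T l e).run
  swapAt q (e - 1)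
  let p ← readAt (e - 1)
  let c ← part p l (e - 1)
  swapAt (max l (min c (e - 1))) (e - 1)
  return max l (min c (e - 1))

theorem quicksort_eq (part : ℕ → ℕ → ℕ → Prog ℕ) (T : PivotMethod) (M l e : ℕ) :
    quicksort part T M l e = (branch (M < e - l) >>= fun _ =>
      if M < e - l then
        divide part T l e >>= fun cut => do
          quicksort part T M l cut
          quicksort part T M (cut + 1) e
      else
        insertionSort l e) := by
  rw [quicksort]
  rfl

theorem PivotTree.run_eq (t : PivotTree) (s : Machine) :
    (t.run.run s).1 = t.choice s.mem ∧ (t.run.run s).2.mem = s.mem := by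
  induction t generalizing s with
  | take i => exact ⟨rfl, rfl⟩
  | test i j t f iht ihf =>
    have hb : ∀ c s, (((branch (c = true) : Prog Unit) >>= fun _ =>
        if c then t.run else f.run).run s).1 = (if c then t.choice s.mem else f.choice s.mem) ∧
        (((branch (c = true) : Prog Unit) >>= fun _ => if c then t.run else f.run).run s).2.mem =
          s.mem := by
      rintro (_ | _) s
      · exact ihf { s with mispredictions := s.mispredictions + 1 }
      · exact iht s
    have := hb (decide (s.mem i < s.mem j)) { s with comparisons := s.comparisons + 1 }
    exact ⟨this.1.trans (by simp [choice]), this.2⟩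

theorem PivotTree.choice_mem_sample (t : PivotTree) (A : ℕ → ℕ) : t.choice A ∈ t.sample := by
  induction t with
  | take i => simp [choice, sample]
  | test i j t f iht ihf =>
    simp only [choice, sample]
    split_ifs <;> simp [*]

theorem PivotTree.choice_congr (t : PivotTree) {A A' : ℕ → ℕ} (h : ∀ i ∈ t.sample, A i = A' i) :
    t.choice A = t.choice A' := by
  induction t with
  | take i => rfl
  | test i j t f iht ihf =>
    simp only [sample, Finset.mem_union, Finset.mem_insert, Finset.mem_singleton] at h
    simp only [choice, h i (by simp), h j (by simp), iht fun a ha => h a (by simp [ha]),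
      ihf fun a ha => h a (by simp [ha])]

theorem divide_mem (part : ℕ → ℕ → ℕ → Prog ℕ) (T : PivotMethod) {l e : ℕ} (h : l < e)
    (s : Machine) : l ≤ ((divide part T l e).run s).1 ∧ ((divide part T l e).run s).1 < e := by
  have : ∃ c, ((divide part T l e).run s).1 = max l (min c (e - 1)) := ⟨_, rfl⟩
  obtain ⟨c, hc⟩ := this
  rw [hc]
  omega

/-- The state `s'` is the one with the pivot parked at the right end; its counters are irrelevant.
-/
theorem divide_run (part : ℕ → ℕ → ℕ → Prog ℕ) (T : PivotMethod) (l e : ℕ) (s : Machine) :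
    ∃ s' : Machine, s'.mem = s.mem ∘ Equiv.swap ((T l e).choice s.mem) (e - 1) ∧
      ((divide part T l e).run s).1 = max l (min ((part (s'.mem (e - 1)) l (e - 1)).run s').1
        (e - 1)) ∧
      ((divide part T l e).run s).2.mem = ((part (s'.mem (e - 1)) l (e - 1)).run s').2.mem ∘
        Equiv.swap (max l (min ((part (s'.mem (e - 1)) l (e - 1)).run s').1 (e - 1))) (e - 1) := by
  refine ⟨((swapAt (((T l e).run.run s).1) (e - 1)).run ((T l e).run.run s).2).2, ?_, rfl, rfl⟩
  obtain ⟨h₁, h₂⟩ := (T l e).run_eq s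
  rw [← h₁]
  have : ∀ i j (s : Machine), ((swapAt i j).run s).2.mem = s.mem ∘ Equiv.swap i j :=
    fun _ _ _ => rfl
  rw [this, h₂]

/-- The pivot of `[l, e)` in the array `A`. -/
def pivot (T : PivotMethod) (l e : ℕ) (A : ℕ → ℕ) : ℕ := A ((T l e).choice A)

/-- The cut and the rearrangement are found for one array `A`, but serve every array with the same
pivot that compares with it in the same way. This uniformity is what later allows keys to be
permuted on one side of the pivot. -/
theorem divide_spec {part : ℕ → ℕ → ℕ → Prog ℕ} (hpart : IsPartitioner part) {T : PivotMethod}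
    {k : ℕ} (hT : T.HasConstantSample k) {l e : ℕ} (hle : l < e) {A : ℕ → ℕ}
    (hA : Set.InjOn A (Set.Ico l e)) :
    ∃ (c : ℕ) (ρ : Equiv.Perm ℕ), SupportedIn ρ l e ∧ l ≤ c ∧ c < e ∧
      A (ρ c) = pivot T l e A ∧ (∀ i, l ≤ i → i < c → A (ρ i) < pivot T l e A) ∧
      (∀ i, c < i → i < e → pivot T l e A < A (ρ i)) ∧
      ∀ s : Machine, (T l e).choice s.mem = (T l e).choice A → pivot T l e s.mem = pivot T l e A →
        Agree (pivot T l e A) l e A s.mem →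
        ((divide part T l e).run s).1 = c ∧ ((divide part T l e).run s).2.mem = s.mem ∘ ρ := by
  have hq := hT.sample_subset l e hle ((T l e).choice_mem_sample A)
  rw [Finset.mem_Ico] at hq
  have hpq : pivot T l e A = A ((T l e).choice A) := rfl
  generalize hqd : (T l e).choice A = q at *
  generalize pivot T l e A = p at *
  have hsw : SupportedIn (Equiv.swap q (e - 1)) l e := .swap hq (by omega)
  have hlast : (A ∘ Equiv.swap q (e - 1)) (e - 1) = p := by simp [hpq]
  have hav : Avoids p l (e - 1) (A ∘ Equiv.swap q (e - 1)) := by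
    intro i hi hi' hp
    rw [hpq] at hp
    have h₁ := hsw.mem (i := i) ⟨hi, by omega⟩
    have h₂ : Equiv.swap q (e - 1) i = q := hA h₁ hq hp
    rw [Equiv.swap_apply_eq_iff] at h₂
    simp at h₂
    omega
  obtain ⟨c, ρ, hρ, ⟨hc, hlow, hhigh⟩, hrun⟩ := hpart p l (e - 1) (by omega) _ hav trivial
  have hclamp : max l (min c (e - 1)) = c := by omega
  -- Rearrangements act on positions, so the exchange performed last is applied first.
  refine ⟨c, ((Equiv.swap c (e - 1)).trans ρ).trans (Equiv.swap q (e - 1)),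
    hsw.trans ((hρ.mono le_rfl (Nat.sub_le _ _)).trans (.swap (by omega) (by omega))),
    hc.1, by omega, ?_, fun i hi hi' => ?_, fun i hi hi' => ?_, fun s hs hp hag => ?_⟩
  · have : ρ (e - 1) = e - 1 := hρ _ (by omega)
    simp [this, hpq]
  · simpa [Equiv.swap_apply_of_ne_of_ne (show i ≠ c by omega) (show i ≠ e - 1 by omega)]
      using hlow i hi hi'
  · by_cases hie : i = e - 1
    · subst hie
      simpa using hhigh c le_rfl (by omega)
    · simpa [Equiv.swap_apply_of_ne_of_ne (show i ≠ c by omega) hie]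
        using hhigh i (by omega) (by omega)
  · obtain ⟨s', hs', h₁, h₂⟩ := divide_run part T l e s
    rw [hs] at hs'
    have hp' : s'.mem (e - 1) = p := by
      rw [← hp, hs']
      simp [pivot, hs]
    rw [hp'] at h₁ h₂
    obtain ⟨h₃, h₄⟩ := hrun s' (by
      rw [hs']
      exact fun i hi hi' => (hag.comp hsw) i hi (by omega))
    rw [h₃, hclamp] at h₁ h₂
    exact ⟨h₁, by rw [h₂, h₄, hs']; rfl⟩

/-! ### Sums over the recursive calls -/

/-- The sum of `τ (e' - l')` over all nonempty subarrays `[l', e')` in the recursion of Quicksort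
without a threshold. -/
noncomputable def tollSum (part : ℕ → ℕ → ℕ → Prog ℕ) (T : PivotMethod) (τ : ℕ → ℝ) (l e : ℕ)
    (A : ℕ → ℕ) : ℝ :=
  if l < e then
    τ (e - l) +
      tollSum part T τ l ((divide part T l e).run ⟨A, 0, 0⟩).1
        ((divide part T l e).run ⟨A, 0, 0⟩).2.mem +
      tollSum part T τ (((divide part T l e).run ⟨A, 0, 0⟩).1 + 1) e
        ((divide part T l e).run ⟨A, 0, 0⟩).2.mem
  else 0
termination_by e - l
decreasing_by
  all_goals
    have := divide_mem part T ‹l < e› ⟨A, 0, 0⟩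
    omega

theorem tollSum_of_lt {part : ℕ → ℕ → ℕ → Prog ℕ} {T : PivotMethod} {τ : ℕ → ℝ} {l e c : ℕ}
    {A A' : ℕ → ℕ} (h : l < e)
    (hrun : ((divide part T l e).run ⟨A, 0, 0⟩).1 = c ∧
      ((divide part T l e).run ⟨A, 0, 0⟩).2.mem = A') :
    tollSum part T τ l e A =
      τ (e - l) + tollSum part T τ l c A' + tollSum part T τ (c + 1) e A' := by
  rw [tollSum, if_pos h, hrun.1, hrun.2]

theorem tollSum_of_le {part : ℕ → ℕ → ℕ → Prog ℕ} {T : PivotMethod} {τ : ℕ → ℝ} {l e : ℕ}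
    {A : ℕ → ℕ} (h : e ≤ l) : tollSum part T τ l e A = 0 := by
  rw [tollSum, if_neg (by omega)]

theorem SupportedIn.injOn {ρ : Equiv.Perm ℕ} {l e : ℕ} (h : SupportedIn ρ l e) {A : ℕ → ℕ}
    (hA : Set.InjOn A (Set.Ico l e)) : Set.InjOn (A ∘ ρ) (Set.Ico l e) :=
  fun _ hi _ hj hij => ρ.injective (hA (h.mem hi) (h.mem hj) hij)

/-- Makes the sum for a subarray insensitive to what surrounds it, in particular to the sorting of
the other side. -/
theorem tollSum_congr {part : ℕ → ℕ → ℕ → Prog ℕ} (hpart : IsPartitioner part) {T : PivotMethod}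
    {k : ℕ} (hT : T.HasConstantSample k) (τ : ℕ → ℝ) {l e : ℕ} {A A' : ℕ → ℕ}
    (hA : Set.InjOn A (Set.Ico l e))
    (h : ∀ i, l ≤ i → i < e → A i = A' i) :
    tollSum part T τ l e A = tollSum part T τ l e A' := by
  induction hn : e - l using Nat.strong_induction_on generalizing l e A A' with
  | _ n ih =>
  by_cases hle : l < e
  · obtain ⟨c, ρ, hρ, hlc, hce, -, -, -, hrun⟩ := divide_spec hpart hT hle hA
    have h₁ := hrun ⟨A, 0, 0⟩ rfl rfl (.refl _ _ _ _)
    have hch : (T l e).choice A' = (T l e).choice A := by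
      refine (T l e).choice_congr fun i hi => (h i ?_ ?_).symm
      · exact (Finset.mem_Ico.1 (hT.sample_subset l e hle hi)).1
      · exact (Finset.mem_Ico.1 (hT.sample_subset l e hle hi)).2
    have hq := Finset.mem_Ico.1 (hT.sample_subset l e hle ((T l e).choice_mem_sample A))
    have h₂ := hrun ⟨A', 0, 0⟩ hch (by simp only [pivot, hch]; exact (h _ hq.1 hq.2).symm)
      fun i hi hi' => by simp [h i hi hi']
    rw [tollSum_of_lt hle h₁, tollSum_of_lt hle h₂]
    have hinj := hρ.injOn hA
    have hag : ∀ i, l ≤ i → i < e → (A ∘ ρ) i = (A' ∘ ρ) i := fun i hi hi' =>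
      h _ (hρ.mem ⟨hi, hi'⟩).1 (hρ.mem ⟨hi, hi'⟩).2
    rw [ih _ (by omega) (hinj.mono (Set.Ico_subset_Ico_right hce.le))
        (fun i hi hi' => hag i hi (by omega)) rfl,
      ih _ (by omega) (hinj.mono (Set.Ico_subset_Ico_left (by omega)))
        (fun i hi hi' => hag i (by omega) hi') rfl]
  · rw [tollSum_of_le (by omega), tollSum_of_le (by omega)]

/-- The program rearranges `[l, e)`. -/
def Rearranges {α : Type} (l e : ℕ) (x : Prog α) : Prop :=
  ∀ s, ∃ ρ : Equiv.Perm ℕ, SupportedIn ρ l e ∧ (x.run s).2.mem = s.mem ∘ ρ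

theorem Rearranges.bind {α β : Type} {l e : ℕ} {x : Prog α} {f : α → Prog β}
    (hx : Rearranges l e x) (hf : ∀ r, Rearranges l e (f r)) : Rearranges l e (x >>= f) := by
  intro s
  obtain ⟨ρ, hρ, h₁⟩ := hx s
  obtain ⟨ρ', hρ', h₂⟩ := hf (x.run s).1 (x.run s).2
  refine ⟨ρ'.trans ρ, hρ.trans hρ', ?_⟩
  have hrun : (x >>= f).run s = (f (x.run s).1).run (x.run s).2 := rfl
  rw [hrun, h₂, h₁]
  rfl

theorem Rearranges.of_mem_eq {α : Type} {l e : ℕ} {x : Prog α}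
    (h : ∀ s, (x.run s).2.mem = s.mem) : Rearranges l e x :=
  fun s => ⟨Equiv.refl ℕ, .refl l e, h s⟩

theorem Rearranges.branch {l e : ℕ} {c : Prop} [Decidable c] : Rearranges l e (branch c) := by
  unfold BlockQuicksort.branch
  split_ifs
  · exact .of_mem_eq fun _ => rfl
  · exact .of_mem_eq fun _ => rfl

theorem rearranges_insertElement {l e j : ℕ} (hj : j < e) :
    Rearranges l e (insertElement l j) := by
  induction j with
  | zero => exact .of_mem_eq fun _ => rfl
  | succ j ih =>
    rw [insertElement]
    split_ifs with hl
    · refine .bind (.of_mem_eq fun _ => rfl) fun x => .bind (.of_mem_eq fun _ => rfl) fun y =>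
        .bind (.of_mem_eq fun _ => rfl) fun c => ?_
      split_ifs
      · exact .bind (fun s => ⟨_, .swap (by omega) (by omega), rfl⟩) fun _ => ih (by omega)
      · exact .of_mem_eq fun _ => rfl
    · exact .of_mem_eq fun _ => rfl

theorem rearranges_insertionSort {l e : ℕ} : Rearranges l e (insertionSort l e) := by
  refine .bind ?_ fun _ => .bind (.of_mem_eq fun _ => rfl) fun _ => .of_mem_eq fun _ => rfl
  suffices ∀ n, n ≤ e - l - 1 →
      Rearranges l e (repeatBody n (fun i _ => insertElement l (l + 1 + i)) ()) from this _ le_rfl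
  intro n hn
  induction n with
  | zero => exact .of_mem_eq fun _ => rfl
  | succ n ih => exact .bind (ih (by omega)) fun _ => rearranges_insertElement (by omega)

/-- A cost measure `κ` of Quicksort is bounded by a sum over the recursive calls, if this is so for
each call; `δ` is the cost of an empty call. -/
theorem quicksort_cost_le {part : ℕ → ℕ → ℕ → Prog ℕ} (hpart : IsPartitioner part) {T : PivotMethod}
    {k : ℕ} (hT : T.HasConstantSample k) {M : ℕ} {κ : Machine → ℝ} {τ : ℕ → ℝ} {δ : ℝ}
    (hdivide : ∀ l e s, M < e - l →
      κ ((branch (M < e - l) >>= fun _ => divide part T l e).run s).2 + δ ≤ κ s + τ (e - l))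
    (hinsert : ∀ l e s, ¬ M < e - l →
      κ ((branch (M < e - l) >>= fun _ => insertionSort l e).run s).2 ≤
        κ s + tollSum part T τ l e s.mem + δ)
    (l e : ℕ) (s : Machine) (hs : Set.InjOn s.mem (Set.Ico l e)) :
    (∃ ρ, SupportedIn ρ l e ∧ ((quicksort part T M l e).run s).2.mem = s.mem ∘ ρ) ∧
      κ ((quicksort part T M l e).run s).2 ≤ κ s + tollSum part T τ l e s.mem + δ := by
  induction hn : e - l using Nat.strong_induction_on generalizing l e s with
  | _ n ih =>
  rw [quicksort_eq]
  by_cases hM : M < e - l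
  · rw [if_pos hM]
    have hle : l < e := by omega
    obtain ⟨c, ρ, hρ, hlc, hce, -, -, -, hrun⟩ := divide_spec hpart hT hle hs
    have h₁ := hrun ⟨s.mem, 0, 0⟩ rfl rfl (.refl _ _ _ _)
    have hκ := hdivide l e s hM
    have hbm : ((branch (M < e - l)).run s).2.mem = s.mem := by
      simp only [branch, if_pos hM]; rfl
    obtain ⟨h₃, h₄⟩ := hrun ((branch (M < e - l)).run s).2 (by rw [hbm]) (by rw [hbm])
      (by rw [hbm]; exact .refl _ _ _ _)
    have hbind : ((branch (M < e - l) >>= fun _ => divide part T l e).run s) =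
      (divide part T l e).run ((branch (M < e - l)).run s).2 := rfl
    have hall : ((branch (M < e - l) >>= fun _ => divide part T l e >>= fun cut => do
        quicksort part T M l cut
        quicksort part T M (cut + 1) e).run s) =
      (quicksort part T M (((divide part T l e).run ((branch (M < e - l)).run s).2).1 + 1) e).run
        ((quicksort part T M l ((divide part T l e).run ((branch (M < e - l)).run s).2).1).run
        ((divide part T l e).run ((branch (M < e - l)).run s).2).2).2 := rfl
    rw [hall]
    rw [hbind] at hκ
    rw [hbm] at h₄
    rw [h₃]
    generalize ((divide part T l e).run ((branch (M < e - l)).run s).2).2 = s₁ at *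
    have hinj := hρ.injOn hs
    rw [← h₄] at hinj
    obtain ⟨⟨ρ₁, hρ₁, hm₁⟩, hκ₁⟩ := ih _ (by omega) l c s₁
      (hinj.mono (Set.Ico_subset_Ico_right hce.le)) rfl
    generalize ((quicksort part T M l c).run s₁).2 = s₂ at *
    have heq : ∀ i, c + 1 ≤ i → i < e → s₂.mem i = s₁.mem i := fun i hi _ => by
      rw [hm₁, Function.comp, hρ₁ i (by omega)]
    have hinj₂ : Set.InjOn s₂.mem (Set.Ico (c + 1) e) :=
      (hinj.mono (Set.Ico_subset_Ico_left (by omega))).congr fun i hi => (heq i hi.1 hi.2).symm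
    obtain ⟨⟨ρ₂, hρ₂, hm₂⟩, hκ₂⟩ := ih _ (by omega) (c + 1) e s₂ hinj₂ rfl
    refine ⟨⟨(ρ₂.trans ρ₁).trans ρ, hρ.trans ((hρ₁.mono le_rfl hce.le).trans
      (hρ₂.mono (by omega) le_rfl)), by rw [hm₂, hm₁, h₄]; rfl⟩, ?_⟩
    -- The first recursive call has not touched `[c + 1, e)`, so the second sum may be taken for the
    -- array right after partitioning. The two calls contribute `δ` twice, one of which is paid by
    -- `hdivide`.
    rw [tollSum_congr hpart hT τ hinj₂ heq] at hκ₂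
    rw [tollSum_of_lt hle h₁, ← h₄]
    linarith
  · rw [if_neg hM]
    exact ⟨(Rearranges.branch.bind fun _ => rearranges_insertionSort) s, hinsert l e s hM⟩

/-- Every nonempty call removes one pivot, so there are exactly `e - l` such calls and the constant
`K` enters `e - l` times. -/
theorem tollSum_le {part : ℕ → ℕ → ℕ → Prog ℕ} {T : PivotMethod} {τ τ' : ℕ → ℝ} {a K : ℝ}
    (h : ∀ N, 1 ≤ N → τ N ≤ a * τ' N + K) {l e : ℕ} (hle : l ≤ e) (A : ℕ → ℕ) :
    tollSum part T τ l e A ≤ a * tollSum part T τ' l e A + K * ((e : ℝ) - l) := by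
  induction hn : e - l using Nat.strong_induction_on generalizing l e A with
  | _ n ih =>
  rcases hle.eq_or_lt with rfl | hlt
  · simp [tollSum_of_le]
  · have hc := divide_mem part T hlt ⟨A, 0, 0⟩
    rw [tollSum_of_lt hlt ⟨rfl, rfl⟩, tollSum_of_lt hlt ⟨rfl, rfl⟩]
    generalize ((divide part T l e).run ⟨A, 0, 0⟩).2.mem = A'
    generalize ((divide part T l e).run ⟨A, 0, 0⟩).1 = c at *
    have h₁ := h (e - l) (by omega)
    have h₂ := ih _ (by omega) hc.1 A' rfl
    have h₃ := ih _ (by omega) (show c + 1 ≤ e by omega) A' rfl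
    push_cast at h₃
    linarith

theorem tollSum_nonneg {part : ℕ → ℕ → ℕ → Prog ℕ} {T : PivotMethod} {τ : ℕ → ℝ} {l e : ℕ}
    (h : ∀ N, N ≤ e - l → 0 ≤ τ N) (A : ℕ → ℕ) : 0 ≤ tollSum part T τ l e A := by
  induction hn : e - l using Nat.strong_induction_on generalizing l e A with
  | _ n ih =>
  rcases le_or_gt e l with hle | hlt
  · rw [tollSum_of_le hle]
  · have hc := divide_mem part T hlt ⟨A, 0, 0⟩
    rw [tollSum_of_lt hlt ⟨rfl, rfl⟩]
    generalize ((divide part T l e).run ⟨A, 0, 0⟩).2.mem = A'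
    generalize ((divide part T l e).run ⟨A, 0, 0⟩).1 = c at *
    have h₁ := h (e - l) le_rfl
    have h₂ := ih (c - l) (by omega) (fun N hN => h N (by omega)) A' rfl
    have h₃ := ih (e - (c + 1)) (by omega) (fun N hN => h N (by omega)) A' rfl
    linarith

theorem toll_le_tollSum {part : ℕ → ℕ → ℕ → Prog ℕ} {T : PivotMethod} {τ : ℕ → ℝ} {l e : ℕ}
    (hle : l < e) (h : ∀ N, N ≤ e - l → 0 ≤ τ N) (A : ℕ → ℕ) :
    τ (e - l) ≤ tollSum part T τ l e A := by
  have hc := divide_mem part T hle ⟨A, 0, 0⟩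
  rw [tollSum_of_lt hle ⟨rfl, rfl⟩]
  have h₁ := tollSum_nonneg (part := part) (T := T) (τ := τ) (l := l)
    (e := ((divide part T l e).run ⟨A, 0, 0⟩).1) (fun N hN => h N (by omega))
    ((divide part T l e).run ⟨A, 0, 0⟩).2.mem
  have h₂ := tollSum_nonneg (part := part) (T := T) (τ := τ)
    (l := ((divide part T l e).run ⟨A, 0, 0⟩).1 + 1) (e := e) (fun N hN => h N (by omega))
    ((divide part T l e).run ⟨A, 0, 0⟩).2.mem
  linarith

/-! ### Tolls of a single call for the two algorithms -/

theorem divide_mispredictions {B : ℕ+} {T : PivotMethod} {k l e : ℕ} (hT : T.HasConstantSample k)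
    (hle : l < e) :
    Counts Machine.mispredictions (divide (blockPartition B) T l e) fun _ d =>
      B * d ≤ 5 * (e - 1 - l) + B * (12 + k) := by
  refine .bind (T l e).run_mispredictions fun _ d₁ h₁ => .bind .mispredictions_swapAt
    fun _ d₂ h₂ => .bind .mispredictions_readAt fun _ d₃ h₃ =>
    .bind blockPartition_mispredictions fun _ d₄ h₄ => .bind .mispredictions_swapAt
    fun _ d₅ h₅ => .pure ?_
  have h : (B : ℕ) * d₁ ≤ B * k := Nat.mul_le_mul_left _ (h₁.trans (hT.depth_le l e hle))
  subst h₂ h₃ h₅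
  simp only [mul_add, zero_add, add_zero] at h₄ ⊢
  omega

theorem divide_comparisons {T : PivotMethod} {l e : ℕ} :
    Counts Machine.comparisons (divide hoarePartition T l e) fun _ d => e - 1 - l ≤ d := by
  refine .bind (T l e).run_comparisons fun _ d₁ h₁ => .bind .comparisons_swapAt
    fun _ d₂ h₂ => .bind .comparisons_readAt fun _ d₃ h₃ =>
    .bind hoarePartition_comparisons fun _ d₄ h₄ => .bind .comparisons_swapAt
    fun _ d₅ h₅ => .pure ?_
  omega

/-- A bound for the mispredictions of BlockQuicksort in a call for `N ≥ 1` elements. -/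
noncomputable def blockToll (B : ℕ+) (k M N : ℕ) : ℝ := 5 / (B : ℝ) * ((N : ℝ) - 1) + (k + M + 20)

/-- Even at `N = 0` the first summand is at least -5, which the constant 20 absorbs. -/
theorem blockToll_nonneg {B : ℕ+} {k M N : ℕ} : 0 ≤ blockToll B k M N := by
  have hB : (1 : ℝ) ≤ (B : ℝ) := by exact_mod_cast B.pos
  have h₁ : 5 / (B : ℝ) ≤ 5 := div_le_self (by norm_num) hB
  have h₂ : 0 ≤ 5 / (B : ℝ) := by positivity
  have h₃ : 0 ≤ 5 / (B : ℝ) * N := by positivity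
  have h₄ : (0 : ℝ) ≤ k := by positivity
  have h₅ : (0 : ℝ) ≤ M := by positivity
  unfold blockToll
  linarith

theorem sorted_mispredictions_le (B : ℕ+) {T : PivotMethod} {k : ℕ} (hT : T.HasConstantSample k)
    (M : ℕ) (l e : ℕ) (s : Machine) (hs : Set.InjOn s.mem (Set.Ico l e)) :
    (((quicksort (blockPartition B) T M l e).run s).2.mispredictions : ℝ) ≤
      s.mispredictions + tollSum (blockPartition B) T (blockToll B k M) l e s.mem + 2 := by
  -- The 2 is the cost of an empty call: the failed threshold test and the exit from the loop of
  -- Insertionsort.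
  refine (quicksort_cost_le (isPartitioner_blockPartition B) hT
    (κ := fun s => (s.mispredictions : ℝ)) ?_ ?_ l e s hs).2
  · intro l e s hM
    have hcount : Counts Machine.mispredictions
        (branch (M < e - l) >>= fun _ => divide (blockPartition B) T l e)
        fun _ d => B * d ≤ 5 * (e - 1 - l) + B * (12 + k) :=
      .bind .mispredictions_branch fun _ d hd => by
        rw [if_pos hM] at hd
        subst hd
        simpa only [zero_add] using divide_mispredictions hT (by omega)
    obtain ⟨d, hd, hd'⟩ := hcount s
    rw [hd]
    have hB : (0 : ℝ) < (B : ℝ) := by exact_mod_cast B.pos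
    have hd'' : (B : ℝ) * d ≤ 5 * ((e - l : ℕ) - 1) + B * (12 + k) := by
      have : ((e - l : ℕ) : ℝ) - 1 = ((e - 1 - l : ℕ) : ℝ) := by
        rw [show e - l = e - 1 - l + 1 by omega]
        push_cast
        ring
      rw [this]
      exact_mod_cast hd'
    have h₁ : (d : ℝ) ≤ 5 / B * ((e - l : ℕ) - 1) + (12 + k) := by
      rw [show 5 / (B : ℝ) * ((e - l : ℕ) - 1) + (12 + k) =
        (5 * ((e - l : ℕ) - 1) + B * (12 + k)) / B by field_simp]
      rw [le_div_iff₀ hB]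
      linarith
    have h₂ : (0 : ℝ) ≤ M := by positivity
    unfold blockToll
    push_cast
    linarith
  · intro l e s hM
    have hcount : Counts Machine.mispredictions
        (branch (M < e - l) >>= fun _ => insertionSort l e)
        fun _ d => d ≤ e - l - 1 + 2 :=
      .bind .mispredictions_branch_le fun _ d hd =>
        insertionSort_mispredictions.post fun _ _ _ => by omega
    obtain ⟨d, hd, hd'⟩ := hcount s
    rw [hd]
    push_cast
    rcases le_or_gt e l with hle | hlt
    · rw [tollSum_of_le hle]
      have : (d : ℝ) ≤ 2 := by exact_mod_cast (show d ≤ 2 by omega)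
      linarith
    · have h₁ := toll_le_tollSum (part := blockPartition B) (T := T) hlt
        (τ := blockToll B k M) (fun _ _ => blockToll_nonneg) s.mem
      have h₂ : (d : ℝ) ≤ M + 2 := by exact_mod_cast (show d ≤ M + 2 by omega)
      have h₃ : (0 : ℝ) ≤ 5 / (B : ℝ) * (((e - l : ℕ) : ℝ) - 1) := by
        have : (1 : ℝ) ≤ ((e - l : ℕ) : ℝ) := by exact_mod_cast (show 1 ≤ e - l by omega)
        exact mul_nonneg (by positivity) (by linarith)
      have h₄ : (0 : ℝ) ≤ k := by positivity
      unfold blockToll at h₁ ⊢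
      linarith

/-- A lower bound for the comparisons of Quicksort in a call for `N ≥ 1` elements. -/
noncomputable def hoareToll (M N : ℕ) : ℝ := if M < N then (N : ℝ) - 1 else 0

/-- The upper bound `quicksort_cost_le` is applied to the negated counter, with negated tolls and `δ
= 0`. Calls below the threshold have toll 0, so their comparisons can be ignored. -/
theorem tollSum_le_sorted_comparisons {T : PivotMethod} {k : ℕ} (hT : T.HasConstantSample k)
    (M : ℕ) (l e : ℕ) (hle : l ≤ e) (s : Machine) (hs : Set.InjOn s.mem (Set.Ico l e)) :
    s.comparisons + tollSum hoarePartition T (hoareToll M) l e s.mem ≤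
      (((quicksort hoarePartition T M l e).run s).2.comparisons : ℝ) := by
  have h := (quicksort_cost_le isPartitioner_hoarePartition hT (M := M) (δ := 0)
    (τ := fun N => -hoareToll M N) (κ := fun s => -(s.comparisons : ℝ)) ?_ ?_ l e s hs).2
  · have h' := tollSum_le (part := hoarePartition) (T := T) (τ := fun N => -hoareToll M N)
      (τ' := hoareToll M) (a := -1) (K := 0) (fun N _ => by simp) hle s.mem
    linarith
  · intro l e s hM
    have hcount : Counts Machine.comparisons
        (branch (M < e - l) >>= fun _ => divide hoarePartition T l e)
        fun _ d => e - 1 - l ≤ d :=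
      .bind .comparisons_branch fun _ d hd => divide_comparisons.post fun _ _ _ => by omega
    obtain ⟨d, hd, hd'⟩ := hcount s
    rw [hd, hoareToll, if_pos hM]
    have : ((e - l : ℕ) : ℝ) ≤ d + 1 := by exact_mod_cast (show e - l ≤ d + 1 by omega)
    push_cast
    linarith
  · intro l e s hM
    have hcount : Counts Machine.comparisons
        (branch (M < e - l) >>= fun _ => insertionSort l e) fun _ _ => True :=
      .bind .comparisons_branch fun _ d hd => insertionSort_comparisons
    obtain ⟨d, hd, -⟩ := hcount s
    have h₁ := tollSum_nonneg (part := hoarePartition) (T := T) (l := l) (e := e)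
      (τ := fun N => -hoareToll M N)
      (fun N hN => by rw [hoareToll, if_neg (by omega)]; simp) s.mem
    rw [hd]
    push_cast
    have : (0 : ℝ) ≤ d := by positivity
    linarith

/-! ### Averages over all arrangements of a set of keys -/

/-- The array that holds the keys `V` in `[l, e)` in the order given by `b`. -/
def place {l e : ℕ} {V : Finset ℕ} (b : Finset.Ico l e ≃ V) (i : ℕ) : ℕ :=
  if h : i ∈ Finset.Ico l e then (b ⟨i, h⟩ : ℕ) else 0

theorem place_of_mem {l e : ℕ} {V : Finset ℕ} (b : Finset.Ico l e ≃ V) {i : ℕ}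
    (h : i ∈ Finset.Ico l e) : place b i = b ⟨i, h⟩ := dif_pos h

theorem place_mem {l e : ℕ} {V : Finset ℕ} (b : Finset.Ico l e ≃ V) {i : ℕ}
    (h : l ≤ i ∧ i < e) : place b i ∈ V := by
  rw [place_of_mem b (Finset.mem_Ico.2 h)]
  exact (b _).2

theorem injOn_place {l e : ℕ} {V : Finset ℕ} (b : Finset.Ico l e ≃ V) :
    Set.InjOn (place b) (Set.Ico l e) := by
  intro i hi j hj hij
  rw [place_of_mem b (Finset.mem_Ico.2 hi), place_of_mem b (Finset.mem_Ico.2 hj)] at hij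
  simpa using b.injective (Subtype.ext hij)

theorem exists_place_eq {l e : ℕ} {V : Finset ℕ} (b : Finset.Ico l e ≃ V) {x : ℕ} (hx : x ∈ V) :
    ∃ i, (l ≤ i ∧ i < e) ∧ place b i = x := by
  refine ⟨b.symm ⟨x, hx⟩, Finset.mem_Ico.1 (b.symm ⟨x, hx⟩).2, ?_⟩
  rw [place_of_mem b (b.symm ⟨x, hx⟩).2]
  simp

/-- The average of `tollSum` over all arrangements of the keys `V` in `[l, e)`. -/
noncomputable def averageTollSum (part : ℕ → ℕ → ℕ → Prog ℕ) (T : PivotMethod) (τ : ℕ → ℝ)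
    (l e : ℕ) (V : Finset ℕ) : ℝ :=
  (∑ b : Finset.Ico l e ≃ V, tollSum part T τ l e (place b)) / ((e - l).factorial : ℝ)

/-- This is where the selection has to be rank-based: changing keys without moving any of them
across the pivot leaves the selected position unchanged. -/
theorem choice_eq_of_agree {T : PivotMethod} {k : ℕ} (hT : T.HasConstantSample k) {l e : ℕ}
    (hle : l < e) {A A' : ℕ → ℕ} (hA : Set.InjOn A (Set.Ico l e))
    (hA' : Set.InjOn A' (Set.Ico l e)) (hp : A' ((T l e).choice A) = pivot T l e A)
    (h : Agree (pivot T l e A) l e A A') : (T l e).choice A' = (T l e).choice A := by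
  have hsub : ((T l e).sample : Set ℕ) ⊆ Set.Ico l e := fun i hi => by
    simpa using hT.sample_subset l e hle hi
  refine hT.isRankBased l e hle A A' (hA.mono hsub) (hA'.mono hsub) fun i hi => ?_
  rw [hp]
  exact (h i (hsub hi).1 (hsub hi).2).1

/-- The rank of the pivot in `V` forces the cut and the key sets of the two parts, whichever correct
partitioner is used; only the order inside the parts depends on the partitioner. -/
theorem divide_place {part : ℕ → ℕ → ℕ → Prog ℕ} (hpart : IsPartitioner part) {T : PivotMethod}
    {k : ℕ} (hT : T.HasConstantSample k) {l e : ℕ} (hle : l < e) {V : Finset ℕ}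
    (b : Finset.Ico l e ≃ V) {p c : ℕ} (hp : pivot T l e (place b) = p)
    (hc : l + (V.filter (· < p)).card = c) :
    p ∈ V ∧ c < e ∧ (V.filter (p < ·)).card = e - (c + 1) ∧
    ∃ ρ : Equiv.Perm ℕ, SupportedIn ρ l e ∧
      (∀ i, l ≤ i → i < c → place b (ρ i) ∈ V.filter (· < p)) ∧
      (∀ i, c + 1 ≤ i → i < e → place b (ρ i) ∈ V.filter (p < ·)) ∧
      ∀ A', Set.InjOn A' (Set.Ico l e) → A' ((T l e).choice (place b)) = p →
        Agree p l e (place b) A' → pivot T l e A' = p ∧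
        ((divide part T l e).run ⟨A', 0, 0⟩).1 = c ∧
        ((divide part T l e).run ⟨A', 0, 0⟩).2.mem = A' ∘ ρ := by
  have hinj := injOn_place b
  obtain ⟨c', ρ, hρ, hlc, hce, hpiv, hlow, hhigh, hrun⟩ := divide_spec hpart hT hle hinj
  have hpc := hp
  rw [hp] at hpiv hlow hhigh hrun
  have hmem : ∀ i, l ≤ i → i < e → place b (ρ i) ∈ V := fun i hi hi' =>
    place_mem b (hρ.mem ⟨hi, hi'⟩)
  have hsurj : ∀ x ∈ V, ∃ i, (l ≤ i ∧ i < e) ∧ place b (ρ i) = x := fun x hx => by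
    obtain ⟨i, hi, rfl⟩ := exists_place_eq b hx
    have hi' : l ≤ ρ.symm i ∧ ρ.symm i < e := by
      by_contra hcon
      have := hρ _ hcon
      rw [Equiv.apply_symm_apply] at this
      exact hcon (this ▸ hi)
    exact ⟨ρ.symm i, hi', by simp⟩
  have hinjρ := hρ.injOn hinj
  have hcard₁ : (V.filter (· < p)).card = c' - l := by
    rw [← Nat.card_Ico]
    symm
    refine Finset.card_bij (fun i _ => place b (ρ i)) ?_ ?_ ?_
    · intro i hi
      rw [Finset.mem_Ico] at hi
      exact Finset.mem_filter.2 ⟨hmem i hi.1 (by omega), hlow i hi.1 hi.2⟩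
    · intro i hi j hj hij
      rw [Finset.mem_Ico] at hi hj
      exact hinjρ ⟨hi.1, by omega⟩ ⟨hj.1, by omega⟩ hij
    · intro x hx
      obtain ⟨hx, hxp⟩ := Finset.mem_filter.1 hx
      obtain ⟨i, hi, rfl⟩ := hsurj x hx
      refine ⟨i, Finset.mem_Ico.2 ⟨hi.1, ?_⟩, rfl⟩
      by_contra hcon
      rcases (not_lt.1 hcon).eq_or_lt with rfl | hlt
      · omega
      · have := hhigh i hlt hi.2
        omega
  have hcard₂ : (V.filter (p < ·)).card = e - (c' + 1) := by
    rw [← Nat.card_Ico]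
    symm
    refine Finset.card_bij (fun i _ => place b (ρ i)) ?_ ?_ ?_
    · intro i hi
      rw [Finset.mem_Ico] at hi
      exact Finset.mem_filter.2 ⟨hmem i (by omega) (by omega), hhigh i hi.1 hi.2⟩
    · intro i hi j hj hij
      rw [Finset.mem_Ico] at hi hj
      exact hinjρ ⟨by omega, by omega⟩ ⟨by omega, by omega⟩ hij
    · intro x hx
      obtain ⟨hx, hxp⟩ := Finset.mem_filter.1 hx
      obtain ⟨i, hi, rfl⟩ := hsurj x hx
      refine ⟨i, Finset.mem_Ico.2 ⟨?_, hi.2⟩, rfl⟩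
      by_contra hcon
      rcases (Nat.le_of_lt_succ (not_le.1 hcon)).eq_or_lt with rfl | hlt
      · omega
      · have := hlow i hi.1 hlt
        omega
  obtain rfl : c' = c := by omega
  refine ⟨hpiv ▸ hmem c' hlc hce, hce, hcard₂, ρ, hρ, fun i hi hi' => ?_, fun i hi hi' => ?_,
    fun A' hA' hp' hag => ?_⟩
  · exact Finset.mem_filter.2 ⟨hmem i hi (by omega), hlow i hi hi'⟩
  · exact Finset.mem_filter.2 ⟨hmem i (by omega) hi', hhigh i hi hi'⟩
  · have hch := choice_eq_of_agree hT hle hinj hA' (by rw [hp', hpc]) (by rw [hpc]; exact hag)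
    have hpv : pivot T l e A' = p := by rw [pivot, hch, hp']
    exact ⟨hpv, hrun ⟨A', 0, 0⟩ hch hpv hag⟩

/-- Rearrangement of the keys `V` by a permutation of some of them. -/
def relabel {l e : ℕ} {V U : Finset ℕ} (hUV : U ⊆ V) (h : Equiv.Perm U)
    (b : Finset.Ico l e ≃ V) : Finset.Ico l e ≃ V :=
  b.trans ((Equiv.Perm.ofSubtype h).subtypePerm fun x => by
    by_cases hx : x ∈ U
    · simp [Equiv.Perm.ofSubtype_apply_of_mem h hx, hUV hx, hUV (h ⟨x, hx⟩).2]
    · simp [Equiv.Perm.ofSubtype_apply_of_not_mem h hx])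

theorem place_relabel {l e : ℕ} {V U : Finset ℕ} (hUV : U ⊆ V) (h : Equiv.Perm U)
    (b : Finset.Ico l e ≃ V) {i : ℕ} (hi : l ≤ i ∧ i < e) :
    place (relabel hUV h b) i = Equiv.Perm.ofSubtype h (place b i) := by
  rw [place_of_mem _ (Finset.mem_Ico.2 hi), place_of_mem _ (Finset.mem_Ico.2 hi)]
  rfl

theorem relabel_injective {l e : ℕ} {V U : Finset ℕ} (hUV : U ⊆ V) (h : Equiv.Perm U) :
    Function.Injective (relabel (l := l) (e := e) hUV h) := by
  intro b b' hb
  ext i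
  have := congrArg (fun f => (f i : ℕ)) hb
  simpa [relabel] using this

theorem agree_relabel {l e p : ℕ} {V U : Finset ℕ} (hUV : U ⊆ V)
    (hp : (∀ x ∈ U, x < p) ∨ ∀ x ∈ U, p < x) (h : Equiv.Perm U) (b : Finset.Ico l e ≃ V) :
    Agree p l e (place b) (place (relabel hUV h b)) := by
  intro i hi hi'
  rw [place_relabel hUV h b ⟨hi, hi'⟩]
  by_cases hx : place b i ∈ U
  · have hx' := (h ⟨_, hx⟩).2
    rw [Equiv.Perm.ofSubtype_apply_of_mem h hx]
    rcases hp with hp | hp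
    · have h₁ := hp _ hx
      have h₂ := hp _ hx'
      omega
    · have h₁ := hp _ hx
      have h₂ := hp _ hx'
      omega
  · simp [Equiv.Perm.ofSubtype_apply_of_not_mem h hx]

/-- Randomness is preserved: with pivot `p`, all arrangements of the keys on one side of `p` are
equally likely after partitioning. -/
theorem sum_tollSum_side {part : ℕ → ℕ → ℕ → Prog ℕ} (hpart : IsPartitioner part)
    {T : PivotMethod} {k : ℕ} (hT : T.HasConstantSample k) (τ : ℕ → ℝ) {l e l' e' p : ℕ}
    (hle : l < e) (hl : l ≤ l') (he : e' ≤ e) {V U : Finset ℕ} (hUV : U ⊆ V)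
    (hp : (∀ x ∈ U, x < p) ∨ ∀ x ∈ U, p < x) (hcard : U.card = e' - l')
    (hside : ∀ b : Finset.Ico l e ≃ V, pivot T l e (place b) = p →
      ∃ ρ : Equiv.Perm ℕ, SupportedIn ρ l e ∧
        (∀ i, l' ≤ i → i < e' → place b (ρ i) ∈ U) ∧
        ∀ A', Set.InjOn A' (Set.Ico l e) → A' ((T l e).choice (place b)) = p →
          Agree p l e (place b) A' → pivot T l e A' = p ∧
          ((divide part T l e).run ⟨A', 0, 0⟩).2.mem = A' ∘ ρ) :
    ∑ b : Finset.Ico l e ≃ V with pivot T l e (place b) = p,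
        tollSum part T τ l' e' ((divide part T l e).run ⟨place b, 0, 0⟩).2.mem =
      ∑ b : Finset.Ico l e ≃ V with pivot T l e (place b) = p,
        averageTollSum part T τ l' e' U := by
  classical
  set X : Finset (Finset.Ico l e ≃ V) :=
    Finset.univ.filter fun b => pivot T l e (place b) = p with hX
  set F : (Finset.Ico l e ≃ V) → ℝ := fun b =>
    tollSum part T τ l' e' ((divide part T l e).run ⟨place b, 0, 0⟩).2.mem with hF
  have hpU : p ∉ U := fun h => by rcases hp with hp | hp <;> exact lt_irrefl _ (hp _ h)
  have hpivot : ∀ b : Finset.Ico l e ≃ V, pivot T l e (place b) = p → ∀ h : Equiv.Perm U,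
      place (relabel hUV h b) ((T l e).choice (place b)) = p := fun b hb h => by
    have hq := Finset.mem_Ico.1 (hT.sample_subset l e hle ((T l e).choice_mem_sample (place b)))
    have hb' : place b ((T l e).choice (place b)) = p := hb
    rw [place_relabel hUV h b hq, hb', Equiv.Perm.ofSubtype_apply_of_not_mem h hpU]
  -- The pivot itself is not in `U`, and no key crosses it, so the relabelled arrangement has the
  -- same pivot.
  have hmaps : ∀ h : Equiv.Perm U, ∀ b ∈ X, relabel hUV h b ∈ X := fun h b hb => by
    have hb' := (Finset.mem_filter.1 hb).2
    obtain ⟨ρ, -, -, hrun⟩ := hside b hb'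
    exact Finset.mem_filter.2 ⟨Finset.mem_univ _, (hrun _ (injOn_place _) (hpivot b hb' h)
      (agree_relabel hUV hp h b)).1⟩
  -- An injective map of the finite set `X` into itself is a bijection, so relabelling does not
  -- change the sum.
  have hinv : ∀ h : Equiv.Perm U, ∑ b ∈ X, F (relabel hUV h b) = ∑ b ∈ X, F b := fun h => by
    rw [← Finset.sum_image (f := F) fun _ _ _ _ hab => relabel_injective hUV h hab]
    congr 1
    refine Finset.eq_of_subset_of_card_le (Finset.image_subset_iff.2 (hmaps h)) ?_
    rw [Finset.card_image_of_injective _ (relabel_injective hUV h)]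
  -- All relabellings of `b` undergo the same rearrangement `ρ`; as `h` varies, the part `[l', e')`
  -- therefore takes each arrangement of `U` exactly once. Summing over `b` and `h` in both orders
  -- then gives the claim.
  have hinner : ∀ b ∈ X, ∑ h : Equiv.Perm U, F (relabel hUV h b) =
      ((e' - l').factorial : ℝ) * averageTollSum part T τ l' e' U := fun b hb => by
    have hb' := (Finset.mem_filter.1 hb).2
    obtain ⟨ρ, hρ, hU, hrun⟩ := hside b hb'
    have hbij : Function.Bijective fun i : Finset.Ico l' e' =>
        (⟨place b (ρ i), hU i (Finset.mem_Ico.1 i.2).1 (Finset.mem_Ico.1 i.2).2⟩ : U) := by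
      rw [Fintype.bijective_iff_injective_and_card]
      refine ⟨fun i j hij => ?_, by simp [hcard]⟩
      have hi := Finset.mem_Ico.1 i.2
      have hj := Finset.mem_Ico.1 j.2
      exact Subtype.ext (hρ.injOn (injOn_place b) ⟨by omega, by omega⟩ ⟨by omega, by omega⟩
        (congrArg Subtype.val hij))
    have hFb : ∀ h : Equiv.Perm U, F (relabel hUV h b) =
        tollSum part T τ l' e' (place ((Equiv.ofBijective _ hbij).trans h)) := fun h => by
      have hr := (hrun _ (injOn_place _) (hpivot b hb' h) (agree_relabel hUV hp h b)).2
      simp only [hF, hr]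
      refine (tollSum_congr hpart hT τ (injOn_place _) fun i hi hi' => ?_).symm
      have hρi := hρ.mem (i := i) ⟨by omega, by omega⟩
      rw [place_of_mem _ (Finset.mem_Ico.2 ⟨hi, hi'⟩), Function.comp,
        place_relabel hUV h b hρi, Equiv.Perm.ofSubtype_apply_of_mem h (hU i hi hi')]
      rfl
    rw [averageTollSum, mul_div_cancel₀ _ (by positivity), Finset.sum_congr rfl fun h _ => hFb h]
    exact Fintype.sum_equiv ⟨fun h => (Equiv.ofBijective _ hbij).trans h,
      fun b' => (Equiv.ofBijective _ hbij).symm.trans b', fun h => by ext; simp,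
      fun b' => by ext; simp⟩ _ _ fun h => rfl
  have hfac : ((e' - l').factorial : ℝ) ≠ 0 := by positivity
  refine mul_left_cancel₀ hfac ?_
  calc ((e' - l').factorial : ℝ) * ∑ b ∈ X, F b
      = ∑ h : Equiv.Perm U, ∑ b ∈ X, F (relabel hUV h b) := by
        rw [Finset.sum_congr rfl fun h _ => hinv h, Finset.sum_const, Finset.card_univ,
          Fintype.card_perm, Fintype.card_coe, hcard, nsmul_eq_mul]
    _ = ∑ b ∈ X, ∑ h : Equiv.Perm U, F (relabel hUV h b) := Finset.sum_comm
    _ = _ := by rw [Finset.sum_congr rfl hinner, Finset.mul_sum]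

/-- The recurrence for the average. Its right-hand side refers to the partitioner only through
averages over smaller subarrays. -/
theorem sum_tollSum {part : ℕ → ℕ → ℕ → Prog ℕ} (hpart : IsPartitioner part)
    {T : PivotMethod} {k : ℕ} (hT : T.HasConstantSample k) (τ : ℕ → ℝ) {l e : ℕ}
    (hle : l < e) (V : Finset ℕ) :
    ∑ b : Finset.Ico l e ≃ V, tollSum part T τ l e (place b) =
      ∑ b : Finset.Ico l e ≃ V, (τ (e - l) +
        averageTollSum part T τ l (l + (V.filter (· < pivot T l e (place b))).card)
          (V.filter (· < pivot T l e (place b))) +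
        averageTollSum part T τ (l + (V.filter (· < pivot T l e (place b))).card + 1) e
          (V.filter (pivot T l e (place b) < ·))) := by
  classical
  have hV : ∀ b ∈ (Finset.univ : Finset (Finset.Ico l e ≃ V)), pivot T l e (place b) ∈ V :=
    fun b _ => (divide_place hpart hT hle b rfl rfl).1
  have hsplit : ∀ b : Finset.Ico l e ≃ V, tollSum part T τ l e (place b) = τ (e - l) +
      tollSum part T τ l (l + (V.filter (· < pivot T l e (place b))).card)
        ((divide part T l e).run ⟨place b, 0, 0⟩).2.mem +
      tollSum part T τ (l + (V.filter (· < pivot T l e (place b))).card + 1) e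
        ((divide part T l e).run ⟨place b, 0, 0⟩).2.mem := fun b => by
    obtain ⟨-, -, -, ρ, -, -, -, hrun⟩ := divide_place hpart hT hle b rfl rfl
    exact tollSum_of_lt hle ⟨(hrun _ (injOn_place b) rfl (.refl _ _ _ _)).2.1, rfl⟩
  rw [Finset.sum_congr rfl fun b _ => hsplit b]
  simp only [Finset.sum_add_distrib]
  congr 1
  · congr 1
    -- For a fixed value of the pivot the cut and the key set of the left part are fixed, so
    -- `sum_tollSum_side` applies to each fibre.
    rw [← Finset.sum_fiberwise_of_maps_to hV, ← Finset.sum_fiberwise_of_maps_to hV]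
    refine Finset.sum_congr rfl fun p _ => ?_
    have h₁ : ∀ b ∈ Finset.univ.filter fun b : Finset.Ico l e ≃ V => pivot T l e (place b) = p,
        pivot T l e (place b) = p := fun b hb => (Finset.mem_filter.1 hb).2
    rw [Finset.sum_congr rfl fun b hb => by rw [h₁ b hb]]
    conv_rhs => rw [Finset.sum_congr rfl fun b hb => by rw [h₁ b hb]]
    rcases Finset.eq_empty_or_nonempty
      (Finset.univ.filter fun b : Finset.Ico l e ≃ V => pivot T l e (place b) = p) with h₀ | ⟨b, hb⟩
    · rw [h₀, Finset.sum_empty, Finset.sum_empty]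
    have hc := divide_place hpart hT hle b (h₁ b hb) rfl
    refine sum_tollSum_side hpart hT τ hle le_rfl hc.2.1.le (Finset.filter_subset _ _)
      (.inl fun x hx => (Finset.mem_filter.1 hx).2) (by omega) fun b hb => ?_
    obtain ⟨-, -, -, ρ, hρ, h, -, hrun⟩ := divide_place hpart hT hle b hb rfl
    exact ⟨ρ, hρ, h, fun A' h₁ h₂ h₃ => ⟨(hrun A' h₁ h₂ h₃).1, (hrun A' h₁ h₂ h₃).2.2⟩⟩
  · rw [← Finset.sum_fiberwise_of_maps_to hV, ← Finset.sum_fiberwise_of_maps_to hV]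
    refine Finset.sum_congr rfl fun p _ => ?_
    have h₁ : ∀ b ∈ Finset.univ.filter fun b : Finset.Ico l e ≃ V => pivot T l e (place b) = p,
        pivot T l e (place b) = p := fun b hb => (Finset.mem_filter.1 hb).2
    rw [Finset.sum_congr rfl fun b hb => by rw [h₁ b hb]]
    conv_rhs => rw [Finset.sum_congr rfl fun b hb => by rw [h₁ b hb]]
    rcases Finset.eq_empty_or_nonempty
      (Finset.univ.filter fun b : Finset.Ico l e ≃ V => pivot T l e (place b) = p) with h₀ | ⟨b, hb⟩
    · rw [h₀, Finset.sum_empty, Finset.sum_empty]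
    have hc := divide_place hpart hT hle b (h₁ b hb) rfl
    refine sum_tollSum_side hpart hT τ hle (by omega) le_rfl (Finset.filter_subset _ _)
      (.inr fun x hx => (Finset.mem_filter.1 hx).2) hc.2.2.1 fun b hb => ?_
    obtain ⟨-, -, -, ρ, hρ, -, h, hrun⟩ := divide_place hpart hT hle b hb rfl
    exact ⟨ρ, hρ, h, fun A' h₁ h₂ h₃ => ⟨(hrun A' h₁ h₂ h₃).1, (hrun A' h₁ h₂ h₃).2.2⟩⟩

/-- The average does not depend on the partitioner. -/
theorem averageTollSum_eq {part part' : ℕ → ℕ → ℕ → Prog ℕ} (hpart : IsPartitioner part)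
    (hpart' : IsPartitioner part') {T : PivotMethod} {k : ℕ} (hT : T.HasConstantSample k)
    (τ : ℕ → ℝ) (l e : ℕ) (V : Finset ℕ) :
    averageTollSum part T τ l e V = averageTollSum part' T τ l e V := by
  induction hn : e - l using Nat.strong_induction_on generalizing l e V with
  | _ n ih =>
  unfold averageTollSum
  congr 1
  rcases le_or_gt e l with hle | hlt
  · simp only [tollSum_of_le hle]
  -- Both recurrences have the same form with the same pivots, so induction replaces the averages on
  -- the right.
  · rw [sum_tollSum hpart hT τ hlt, sum_tollSum hpart' hT τ hlt]
    refine Finset.sum_congr rfl fun b _ => ?_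
    have hc := divide_place hpart hT hlt b rfl rfl
    rw [ih _ (by omega) _ _ _ rfl, ih _ (by omega) _ _ _ rfl]

/-! ### Median-of-three -/

theorem isRankBased_medianTree (a b c : ℕ) : (medianTree a b c).IsRankBased := by
  intro A A' hA hA' h
  have hs : (medianTree a b c).sample = {a, b, c} := by
    ext x
    simp only [medianTree, PivotTree.sample, Finset.mem_union, Finset.mem_insert,
      Finset.mem_singleton]
    tauto
  rw [hs] at hA hA' h
  simp only [Finset.mem_insert, Finset.mem_singleton, forall_eq_or_imp, forall_eq] at h
  have hab := hA.eq_iff (x := a) (y := b) (by simp) (by simp)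
  have hac := hA.eq_iff (x := a) (y := c) (by simp) (by simp)
  have hbc := hA.eq_iff (x := b) (y := c) (by simp) (by simp)
  have hab' := hA'.eq_iff (x := a) (y := b) (by simp) (by simp)
  have hac' := hA'.eq_iff (x := a) (y := c) (by simp) (by simp)
  have hbc' := hA'.eq_iff (x := b) (y := c) (by simp) (by simp)
  simp only [medianTree, PivotTree.choice] at h ⊢
  split_ifs at h ⊢ <;> omega

theorem hasConstantSample_medianOfThree : medianOfThree.HasConstantSample 3 where
  sample_subset l e hle x hx := by
    simp only [medianOfThree, medianTree, PivotTree.sample, Finset.mem_union, Finset.mem_insert,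
      Finset.mem_singleton] at hx
    rw [Finset.mem_Ico]
    omega
  depth_le l e _ := by simp [medianOfThree, medianTree, PivotTree.depth]
  isRankBased l e _ := isRankBased_medianTree _ _ _

open Classical in
/-- All ordered triples of keys are equally likely at three given positions. -/
theorem exists_card_triple (l e : ℕ) (V : Finset ℕ) {i j k : ℕ} (hi : l ≤ i ∧ i < e)
    (hj : l ≤ j ∧ j < e) (hk : l ≤ k ∧ k < e) :
    ∃ c : ℕ, ∀ x ∈ V, ∀ y ∈ V, ∀ z ∈ V, x ≠ y → x ≠ z → y ≠ z →
      (Finset.univ.filter fun b : Finset.Ico l e ≃ V =>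
        place b i = x ∧ place b j = y ∧ place b k = z).card = c := by
  by_cases hex : ∃ x ∈ V, ∃ y ∈ V, ∃ z ∈ V, x ≠ y ∧ x ≠ z ∧ y ≠ z
  swap
  · exact ⟨0, fun x hx y hy z hz h₁ h₂ h₃ => (hex ⟨x, hx, y, hy, z, hz, h₁, h₂, h₃⟩).elim⟩
  obtain ⟨x, hx, y, hy, z, hz, hxy, hxz, hyz⟩ := hex
  refine ⟨(Finset.univ.filter fun b : Finset.Ico l e ≃ V =>
    place b i = x ∧ place b j = y ∧ place b k = z).card, fun x' hx' y' hy' z' hz' h₁ h₂ h₃ => ?_⟩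
  have hemb : ∀ x y z : V, x ≠ y → x ≠ z → y ≠ z → Function.Injective ![x, y, z] := by
    intro x y z h₁ h₂ h₃ a b hab
    fin_cases a <;> fin_cases b <;> simp_all [eq_comm]
  -- The symmetric group is 3-transitive, and composition with `g` maps the arrangements for one
  -- triple bijectively to those for the other.
  obtain ⟨g, hg⟩ := (Equiv.Perm.isMultiplyPretransitive V 3).exists_smul_eq
    ⟨![⟨x', hx'⟩, ⟨y', hy'⟩, ⟨z', hz'⟩], hemb _ _ _ (by simpa) (by simpa) (by simpa)⟩
    ⟨![⟨x, hx⟩, ⟨y, hy⟩, ⟨z, hz⟩], hemb _ _ _ (by simpa) (by simpa) (by simpa)⟩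
  have hgx : g ⟨x', hx'⟩ = ⟨x, hx⟩ := by simpa using DFunLike.congr_fun hg 0
  have hgy : g ⟨y', hy'⟩ = ⟨y, hy⟩ := by simpa using DFunLike.congr_fun hg 1
  have hgz : g ⟨z', hz'⟩ = ⟨z, hz⟩ := by simpa using DFunLike.congr_fun hg 2
  have key : ∀ (b : Finset.Ico l e ≃ V) (a u v : ℕ) (ha : l ≤ a ∧ a < e) (hu : u ∈ V)
      (hv : v ∈ V), g ⟨u, hu⟩ = ⟨v, hv⟩ → (place b a = u ↔ place (b.trans g) a = v) := by
    intro b a u v ha hu hv hguv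
    rw [place_of_mem _ (Finset.mem_Ico.2 ha), place_of_mem _ (Finset.mem_Ico.2 ha)]
    have h₁ : ((b ⟨a, Finset.mem_Ico.2 ha⟩ : V) : ℕ) = u ↔
        b ⟨a, Finset.mem_Ico.2 ha⟩ = ⟨u, hu⟩ := by rw [Subtype.ext_iff]
    have h₂ : (((b.trans g) ⟨a, Finset.mem_Ico.2 ha⟩ : V) : ℕ) = v ↔
        g (b ⟨a, Finset.mem_Ico.2 ha⟩) = ⟨v, hv⟩ := by rw [Subtype.ext_iff]; rfl
    rw [h₁, h₂, ← hguv, g.injective.eq_iff]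
  refine Finset.card_bij (fun b _ => b.trans g) (fun b hb => ?_) (fun b _ b' _ hbb => ?_)
    fun b hb => ⟨b.trans g.symm, ?_, ?_⟩
  · simp only [Finset.mem_filter, Finset.mem_univ, true_and] at hb ⊢
    exact ⟨(key b i _ _ hi hx' hx hgx).1 hb.1, (key b j _ _ hj hy' hy hgy).1 hb.2.1,
      (key b k _ _ hk hz' hz hgz).1 hb.2.2⟩
  · ext a
    have := DFunLike.congr_fun hbb a
    simpa using this
  · have hbg : (b.trans g.symm).trans g = b := by ext; simp
    simp only [Finset.mem_filter, Finset.mem_univ, true_and] at hb ⊢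
    exact ⟨(key _ i _ _ hi hx' hx hgx).2 (by rw [hbg]; exact hb.1),
      (key _ j _ _ hj hy' hy hgy).2 (by rw [hbg]; exact hb.2.1),
      (key _ k _ _ hk hz' hz hgz).2 (by rw [hbg]; exact hb.2.2)⟩
  · ext; simp

-- Given `p` at one position, the keys at the other two can be chosen in (number below `p`) times
-- (number above `p`) ways, all with the same number of arrangements.
open Classical in
theorem exists_card_between (l e : ℕ) (V : Finset ℕ) {i j k : ℕ} (hi : l ≤ i ∧ i < e)
    (hj : l ≤ j ∧ j < e) (hk : l ≤ k ∧ k < e) :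
    ∃ c : ℕ, ∀ p ∈ V, (Finset.univ.filter fun b : Finset.Ico l e ≃ V =>
        place b i < p ∧ place b j = p ∧ p < place b k).card =
      c * ((V.filter (· < p)).card * (V.filter (p < ·)).card) := by
  obtain ⟨c, hc⟩ := exists_card_triple l e V hi hj hk
  refine ⟨c, fun p hp => ?_⟩
  rw [Finset.card_eq_sum_card_fiberwise (f := fun b => (place b i, place b k))
    (t := V.filter (· < p) ×ˢ V.filter (p < ·))]
  · rw [Finset.sum_congr rfl (g := fun _ => c), Finset.sum_const, Finset.card_product,
      smul_eq_mul, mul_comm]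
    rintro ⟨x, z⟩ hxz
    simp only [Finset.mem_product, Finset.mem_filter] at hxz
    rw [← hc x hxz.1.1 p hp z hxz.2.1 (by omega) (by omega) (by omega), Finset.filter_filter]
    congr 1
    ext b
    simp only [Finset.mem_filter, Finset.mem_univ, true_and, Prod.mk.injEq]
    omega
  · intro b hb
    simp only [Finset.coe_filter, Finset.mem_univ, true_and, Set.mem_ofPred_eq] at hb
    simp only [Finset.coe_product, Finset.coe_filter, Set.mem_prod, Set.mem_ofPred_eq]
    exact ⟨⟨place_mem b hi, hb.1⟩, place_mem b hk, hb.2.2⟩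

theorem indicator_median {x y z : ℕ} (hxy : x ≠ y) (hxz : x ≠ z) (hyz : y ≠ z) (p : ℕ) :
    (if (if x < y then (if y < z then y else if x < z then z else x)
      else if x < z then x else if y < z then z else y) = p then 1 else 0) =
      (if x < p ∧ y = p ∧ p < z then 1 else 0) + (if x < p ∧ z = p ∧ p < y then 1 else 0) +
      (if y < p ∧ x = p ∧ p < z then 1 else 0) + (if y < p ∧ z = p ∧ p < x then 1 else 0) +
      (if z < p ∧ x = p ∧ p < y then 1 else 0) + (if z < p ∧ y = p ∧ p < x then 1 else 0) := by
  split_ifs <;> omega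

theorem pivot_medianOfThree (l e : ℕ) (A : ℕ → ℕ) :
    pivot medianOfThree l e A =
      if A l < A (l + (e - l) / 2) then
        (if A (l + (e - l) / 2) < A (e - 1) then A (l + (e - l) / 2)
          else if A l < A (e - 1) then A (e - 1) else A l)
      else if A l < A (e - 1) then A l
        else if A (l + (e - l) / 2) < A (e - 1) then A (e - 1) else A (l + (e - l) / 2) := by
  simp only [pivot, medianOfThree, medianTree, PivotTree.choice]
  split_ifs <;> rfl

/-- The six orders of the three sample keys each contribute a multiple of `r * s` to the number of
arrangements with a given pivot. The factor `c` need not be computed: taking `G = 1` determines it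
later. -/
theorem sum_pivot_medianOfThree {l e : ℕ} (h3 : l + 3 ≤ e) (V : Finset ℕ) :
    ∃ c : ℝ, ∀ G : ℕ → ℝ, ∑ b : Finset.Ico l e ≃ V, G (pivot medianOfThree l e (place b)) =
      c * ∑ p ∈ V, ((V.filter (· < p)).card * (V.filter (p < ·)).card : ℝ) * G p := by
  classical
  have hi : l ≤ l ∧ l < e := by omega
  have hj : l ≤ l + (e - l) / 2 ∧ l + (e - l) / 2 < e := by omega
  have hk : l ≤ e - 1 ∧ e - 1 < e := by omega
  have hne₁ : l ≠ l + (e - l) / 2 := by omega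
  have hne₂ : l ≠ e - 1 := by omega
  have hne₃ : l + (e - l) / 2 ≠ e - 1 := by omega
  obtain ⟨c₁, h₁⟩ := exists_card_between l e V hi hj hk
  obtain ⟨c₂, h₂⟩ := exists_card_between l e V hi hk hj
  obtain ⟨c₃, h₃⟩ := exists_card_between l e V hj hi hk
  obtain ⟨c₄, h₄⟩ := exists_card_between l e V hj hk hi
  obtain ⟨c₅, h₅⟩ := exists_card_between l e V hk hi hj
  obtain ⟨c₆, h₆⟩ := exists_card_between l e V hk hj hi
  refine ⟨((c₁ + c₂ + c₃ + c₄ + c₅ + c₆ : ℕ) : ℝ), fun G => ?_⟩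
  have hV : ∀ b ∈ (Finset.univ : Finset (Finset.Ico l e ≃ V)),
      pivot medianOfThree l e (place b) ∈ V := fun b _ => by
    rw [pivot_medianOfThree]
    split_ifs <;> first | exact place_mem b hi | exact place_mem b hj | exact place_mem b hk
  rw [← Finset.sum_fiberwise_of_maps_to hV, Finset.mul_sum]
  refine Finset.sum_congr rfl fun p hp => ?_
  have hcard : (Finset.univ.filter fun b : Finset.Ico l e ≃ V =>
      pivot medianOfThree l e (place b) = p).card = (c₁ + c₂ + c₃ + c₄ + c₅ + c₆) *
        ((V.filter (· < p)).card * (V.filter (p < ·)).card) := by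
    simp only [add_mul]
    rw [← h₁ p hp, ← h₂ p hp, ← h₃ p hp, ← h₄ p hp, ← h₅ p hp, ← h₆ p hp]
    simp only [Finset.card_filter, ← Finset.sum_add_distrib]
    refine Finset.sum_congr rfl fun b _ => ?_
    have hinj := injOn_place b
    rw [pivot_medianOfThree]
    exact indicator_median (fun h => hne₁ (hinj hi hj h)) (fun h => hne₂ (hinj hi hk h))
      (fun h => hne₃ (hinj hj hk h)) p
  rw [Finset.sum_congr rfl fun b hb => by rw [(Finset.mem_filter.1 hb).2], Finset.sum_const, hcard,
    nsmul_eq_mul]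
  push_cast
  ring

/-! ### The recurrence for median-of-three -/

theorem sum_range_mul_sub (n : ℕ) (u : ℝ) :
    ∑ r ∈ Finset.range n, (r : ℝ) * (u - r) =
      u * (n * (n - 1) / 2) - (n - 1) * n * (2 * n - 1) / 6 := by
  induction n with
  | zero => simp
  | succ n ih =>
    rw [Finset.sum_range_succ, ih]
    push_cast
    ring

theorem sum_range_mul_sub_sq (n : ℕ) (u : ℝ) :
    ∑ r ∈ Finset.range n, ((r : ℝ) * (u - r)) ^ 2 =
      u ^ 2 * ((n - 1) * n * (2 * n - 1) / 6) - 2 * u * (n * (n - 1) / 2) ^ 2 +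
        n * (n - 1) * (2 * n - 1) * (3 * n ^ 2 - 3 * n - 1) / 30 := by
  induction n with
  | zero => simp
  | succ n ih =>
    rw [Finset.sum_range_succ, ih]
    push_cast
    ring

/-- The first two terms of the series of `-log (1 - x)`, all of whose terms are nonnegative. -/
theorem log_one_sub_le {x : ℝ} (h₀ : 0 ≤ x) (h₁ : x < 1) : Real.log (1 - x) ≤ -x - x ^ 2 / 2 := by
  have h := Real.hasSum_pow_div_log_of_abs_lt_one (x := x) (by rw [abs_of_nonneg h₀]; exact h₁)
  have h' := sum_le_hasSum (Finset.range 2) (fun i _ => by positivity) h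
  norm_num [Finset.sum_range_succ] at h'
  linarith

theorem mul_log_le {r s : ℝ} (hr : 0 ≤ r) (hs : 0 ≤ s) (h : 0 < r + s) :
    r * Real.log r ≤ r * Real.log (r + s) - r * s / (r + s) - r * s ^ 2 / (2 * (r + s) ^ 2) := by
  rcases hr.eq_or_lt with rfl | hr'
  · simp
  · have h₁ := log_one_sub_le (x := s / (r + s)) (by positivity) (by
      rw [div_lt_one h]; linarith)
    have h₂ : 1 - s / (r + s) = r / (r + s) := by field_simp; ring
    rw [h₂, Real.log_div hr'.ne' h.ne'] at h₁
    have h₃ := mul_le_mul_of_nonneg_left h₁ hr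
    have h₄ : r * (-(s / (r + s)) - (s / (r + s)) ^ 2 / 2) =
      -(r * s / (r + s)) - r * s ^ 2 / (2 * (r + s) ^ 2) := by field_simp
    linarith

/-- The second-order term matters: the first-order estimate has 2 in place of 5/2 and would give
only `(5/2) N ln N` in the induction, hence `12.5 ln 2 > 8` in the end. -/
theorem mul_log_add_mul_log_le {r s : ℝ} (hr : 0 ≤ r) (hs : 0 ≤ s) (h : 0 < r + s) :
    r * Real.log r + s * Real.log s ≤
      (r + s) * Real.log (r + s) - 5 / (2 * (r + s)) * (r * s) := by
  have h₁ := mul_log_le hr hs h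
  have h₂ := mul_log_le hs hr (by linarith)
  rw [add_comm s r] at h₂
  have h₃ : r * s / (r + s) + r * s ^ 2 / (2 * (r + s) ^ 2) +
      (s * r / (r + s) + s * r ^ 2 / (2 * (r + s) ^ 2)) = 5 / (2 * (r + s)) * (r * s) := by
    field_simp
    ring
  linarith

/-- Summation over the keys of `V` by their ranks. -/
theorem sum_rank (V : Finset ℕ) (f : ℕ → ℝ) :
    ∑ p ∈ V, f (V.filter (· < p)).card = ∑ r ∈ Finset.range V.card, f r := by
  have hmono : ∀ p ∈ V, ∀ q, p < q → (V.filter (· < p)).card < (V.filter (· < q)).card := by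
    intro p hp q hpq
    refine Finset.card_lt_card ⟨fun x hx => ?_, fun hcon => ?_⟩
    · simp only [Finset.mem_filter] at hx ⊢
      exact ⟨hx.1, by omega⟩
    · have := hcon (Finset.mem_filter.2 ⟨hp, hpq⟩)
      simp at this
  have hmaps : ∀ p ∈ V, (V.filter (· < p)).card ∈ Finset.range V.card := fun p hp =>
    Finset.mem_range.2 (Finset.card_lt_card ⟨Finset.filter_subset _ _, fun hcon => by
      have := hcon hp
      simp at this⟩)
  have hinj : Set.InjOn (fun p => (V.filter (· < p)).card) V := by
    intro p hp q hq hpq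
    rcases lt_trichotomy p q with h | h | h
    · exact absurd hpq (hmono p hp q h).ne
    · exact h
    · exact absurd hpq (hmono q hq p h).ne'
  exact Finset.sum_nbij (fun p => (V.filter (· < p)).card) hmaps hinj
    (Finset.surjOn_of_injOn_of_card_le _ hmaps hinj (by simp)) fun _ _ => rfl

theorem card_filter_lt_add_card_filter_gt {V : Finset ℕ} {p : ℕ} (hp : p ∈ V) :
    (V.filter (· < p)).card + (V.filter (p < ·)).card + 1 = V.card := by
  rw [← Finset.card_union_of_disjoint]
  · rw [← Finset.card_erase_add_one hp]
    congr 2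
    ext x
    simp only [Finset.mem_union, Finset.mem_filter, Finset.mem_erase]
    constructor
    · rintro (⟨h₁, h₂⟩ | ⟨h₁, h₂⟩) <;> exact ⟨by omega, h₁⟩
    · rintro ⟨h₁, h₂⟩
      rcases lt_or_gt_of_ne h₁ with h | h
      · exact .inl ⟨h₂, h⟩
      · exact .inr ⟨h₂, h⟩
  · rw [Finset.disjoint_left]
    intro x hx hx'
    have h₁ := (Finset.mem_filter.1 hx).2
    have h₂ := (Finset.mem_filter.1 hx').2
    omega

theorem card_arrangements {l e : ℕ} {V : Finset ℕ} (hV : V.card = e - l) :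
    Fintype.card (Finset.Ico l e ≃ V) = (e - l).factorial := by
  rw [Fintype.card_equiv (Fintype.equivOfCardEq (by simp [hV]))]
  simp

/-- The average of the product of the numbers of keys on both sides of the pivot. -/
theorem sum_mul_medianOfThree {l e : ℕ} (h3 : l + 3 ≤ e) {V : Finset ℕ} (hV : V.card = e - l) :
    ∑ b : Finset.Ico l e ≃ V,
        ((V.filter (· < pivot medianOfThree l e (place b))).card *
          (V.filter (pivot medianOfThree l e (place b) < ·)).card : ℝ) =
      (e - l).factorial * ((((e : ℝ) - l - 1) ^ 2 + 1) / 5) := by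
  obtain ⟨c, hc⟩ := sum_pivot_medianOfThree h3 V
  -- The total number of arrangements is `c` times the sum of `r (u - r)`, and the sum sought is `c`
  -- times the sum of the squares. The closed forms differ by the factor `(u ^ 2 + 1) / 5`.
  have h₁ := hc fun _ => 1
  have h₂ := hc fun p => ((V.filter (· < p)).card * (V.filter (p < ·)).card : ℝ)
  set u : ℝ := (e : ℝ) - l - 1 with hu
  have hN : ((e - l : ℕ) : ℝ) = u + 1 := by
    rw [Nat.cast_sub (by omega), hu]
    ring
  have hs : ∀ p ∈ V, ((V.filter (p < ·)).card : ℝ) = u - (V.filter (· < p)).card := fun p hp => by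
    have := card_filter_lt_add_card_filter_gt hp
    have h : ((V.filter (· < p)).card : ℝ) + (V.filter (p < ·)).card + 1 = u + 1 := by
      rw [← hN, ← hV]
      exact_mod_cast this
    linarith
  rw [Finset.sum_congr (s₁ := V) rfl fun p hp => by rw [hs p hp, mul_one],
    sum_rank V fun r => (r : ℝ) * (u - r), sum_range_mul_sub, Finset.sum_const, Finset.card_univ,
    card_arrangements hV, hV, hN, nsmul_eq_mul, mul_one] at h₁
  rw [h₂, Finset.sum_congr (s₁ := V) rfl fun p hp => by rw [hs p hp, ← sq],
    sum_rank V fun r => ((r : ℝ) * (u - r)) ^ 2, sum_range_mul_sub_sq, hV, hN, h₁]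
  ring

/-- The constant 2 is what makes the average gain of `mul_log_add_mul_log_le` cover the toll, since
`2 * (5 / 2) * (1 / 5) = 1`. -/
theorem averageTollSum_medianOfThree_le {part : ℕ → ℕ → ℕ → Prog ℕ} (hpart : IsPartitioner part)
    (l e : ℕ) {V : Finset ℕ} (hV : V.card = e - l) :
    averageTollSum part medianOfThree (fun N => (N : ℝ) - 1) l e V ≤
      2 * ((e - l : ℕ) * Real.log (e - l : ℕ)) := by
  induction hn : e - l using Nat.strong_induction_on generalizing l e V with
  | _ n ih =>
  rw [averageTollSum, div_le_iff₀ (by positivity)]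
  rcases le_or_gt e l with hle | hlt
  · simp only [tollSum_of_le hle, Finset.sum_const_zero]
    positivity
  rw [sum_tollSum hpart hasConstantSample_medianOfThree _ hlt]
  set R : (Finset.Ico l e ≃ V) → ℕ := fun b =>
    (V.filter (· < pivot medianOfThree l e (place b))).card with hR
  set S : (Finset.Ico l e ≃ V) → ℕ := fun b =>
    (V.filter (pivot medianOfThree l e (place b) < ·)).card with hS
  have hRS : ∀ b, R b + S b + 1 = n := fun b => by
    have h := card_filter_lt_add_card_filter_gt
      (divide_place hpart hasConstantSample_medianOfThree hlt b rfl rfl).1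
    simp only [hR, hS]
    omega
  have hterm : ∀ b : Finset.Ico l e ≃ V, ((e - l : ℕ) : ℝ) - 1 +
      averageTollSum part medianOfThree (fun N => (N : ℝ) - 1) l (l + R b)
        (V.filter (· < pivot medianOfThree l e (place b))) +
      averageTollSum part medianOfThree (fun N => (N : ℝ) - 1) (l + R b + 1) e
        (V.filter (pivot medianOfThree l e (place b) < ·)) ≤
      (n : ℝ) - 1 + 2 * (R b * Real.log (R b) + S b * Real.log (S b)) := fun b => by
    have hb := hRS b
    have h₁ := ih (R b) (by omega) l (l + R b)
      (V := V.filter (· < pivot medianOfThree l e (place b))) (by simp only [hR]; omega) (by omega)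
    have h₂ := ih (S b) (by omega) (l + R b + 1) e
      (V := V.filter (pivot medianOfThree l e (place b) < ·)) (by
        have : S b = e - (l + R b + 1) := by omega
        exact this) (by omega)
    rw [hn]
    linarith
  refine (Finset.sum_le_sum fun b _ => hterm b).trans ?_
  have hcard : ((n.factorial : ℕ) : ℝ) = ∑ _b : Finset.Ico l e ≃ V, (1 : ℝ) := by
    rw [Finset.sum_const, Finset.card_univ, card_arrangements hV, hn, nsmul_eq_mul, mul_one]
  -- From three elements on, the first, middle and last positions are distinct; one and two elements
  -- are checked directly.
  by_cases h3 : l + 3 ≤ e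
  · have hu : (0 : ℝ) < (n : ℝ) - 1 := by
      have : (3 : ℝ) ≤ n := by exact_mod_cast (show 3 ≤ n by omega)
      linarith
    have hle : ∀ b : Finset.Ico l e ≃ V,
        (n : ℝ) - 1 + 2 * (R b * Real.log (R b) + S b * Real.log (S b)) ≤
          ((n : ℝ) - 1 + 2 * (((n : ℝ) - 1) * Real.log ((n : ℝ) - 1))) * 1 -
            5 / ((n : ℝ) - 1) * (R b * S b) := fun b => by
      have hb : (R b : ℝ) + S b = (n : ℝ) - 1 := by
        rw [← hRS b]
        push_cast
        ring
      have h := mul_log_add_mul_log_le (r := R b) (s := S b) (by positivity) (by positivity)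
        (by rw [hb]; exact hu)
      rw [hb] at h
      have h' : 5 / ((n : ℝ) - 1) * (R b * S b) =
          2 * (5 / (2 * ((n : ℝ) - 1)) * (R b * S b)) := by field_simp
      linarith
    refine (Finset.sum_le_sum fun b _ => hle b).trans ?_
    have hn' : (e : ℝ) - l - 1 = (n : ℝ) - 1 := by
      rw [← hn, Nat.cast_sub hlt.le]
    rw [Finset.sum_sub_distrib, ← Finset.mul_sum, ← Finset.mul_sum, ← hcard,
      sum_mul_medianOfThree h3 hV, hn', hn]
    have hlog : ((n : ℝ) - 1) * Real.log ((n : ℝ) - 1) ≤ n * Real.log n := by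
      have h₁ : (1 : ℝ) ≤ (n : ℝ) - 1 := by
        have : (3 : ℝ) ≤ n := by exact_mod_cast (show 3 ≤ n by omega)
        linarith
      have h₂ : Real.log ((n : ℝ) - 1) ≤ Real.log n := Real.log_le_log hu (by linarith)
      exact mul_le_mul (by linarith) h₂ (Real.log_nonneg h₁) (by positivity)
    have hfac : (0 : ℝ) < n.factorial := by positivity
    -- The total gain: per arrangement it is the toll `n - 1` plus a positive surplus.
    have hquad : 5 / ((n : ℝ) - 1) * (n.factorial * ((((n : ℝ) - 1) ^ 2 + 1) / 5)) =
        n.factorial * ((n : ℝ) - 1 + 1 / ((n : ℝ) - 1)) := by field_simp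
    rw [hquad, mul_comm _ (n.factorial : ℝ), mul_comm _ (n.factorial : ℝ), ← mul_sub]
    have hinv : 0 < 1 / ((n : ℝ) - 1) := by positivity
    exact mul_le_mul_of_nonneg_left (by linarith) hfac.le
  · rw [hn, hcard, Finset.mul_sum]
    refine Finset.sum_le_sum fun b _ => ?_
    have hb := hRS b
    have hzero : ∀ r : ℕ, r ≤ 1 → (r : ℝ) * Real.log r = 0 := fun r hr => by
      interval_cases r <;> simp
    rw [hzero (R b) (by omega), hzero (S b) (by omega)]
    have hlog2 := Real.log_two_gt_d9
    obtain rfl | rfl : n = 1 ∨ n = 2 := by omega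
    · norm_num
    · norm_num
      linarith

/-! ### Averages over all permutations -/

theorem averageTollSum_le {part : ℕ → ℕ → ℕ → Prog ℕ} {T : PivotMethod} {τ τ' : ℕ → ℝ} {a K : ℝ}
    (h : ∀ N, 1 ≤ N → τ N ≤ a * τ' N + K) {l e : ℕ} (hle : l ≤ e) {V : Finset ℕ}
    (hV : V.card = e - l) :
    averageTollSum part T τ l e V ≤ a * averageTollSum part T τ' l e V + K * ((e : ℝ) - l) := by
  have hfac : (0 : ℝ) < (e - l).factorial := by positivity
  have hsum := Finset.sum_le_sum fun (b : Finset.Ico l e ≃ V) (_ : b ∈ Finset.univ) =>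
    tollSum_le (part := part) (T := T) h hle (place b)
  rw [Finset.sum_add_distrib, ← Finset.mul_sum, Finset.sum_const, Finset.card_univ,
    card_arrangements hV, nsmul_eq_mul] at hsum
  unfold averageTollSum
  rw [div_le_iff₀ hfac, add_mul, mul_assoc a, div_mul_cancel₀ _ hfac.ne']
  linarith

theorem sum_tollSum_initial (part : ℕ → ℕ → ℕ → Prog ℕ) (T : PivotMethod) (τ : ℕ → ℝ) (n : ℕ) :
    ∑ π : Equiv.Perm (Fin n), tollSum part T τ 0 n (initial π).mem =
      n.factorial * averageTollSum part T τ 0 n (Finset.range n) := by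
  rw [averageTollSum, Nat.sub_zero, mul_div_cancel₀ _ (by positivity)]
  let φ : Fin n ≃ Finset.Ico 0 n :=
    ⟨fun i => ⟨i, by simp⟩, fun i => ⟨i, (Finset.mem_Ico.1 i.2).2⟩, fun _ => rfl, fun _ => rfl⟩
  let ψ : Fin n ≃ Finset.range n :=
    ⟨fun i => ⟨i, by simp⟩, fun i => ⟨i, Finset.mem_range.1 i.2⟩, fun _ => rfl, fun _ => rfl⟩
  refine Fintype.sum_equiv (Equiv.equivCongr φ ψ) _ _ fun π => ?_
  congr 1
  funext i
  by_cases hi : i < n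
  · rw [place_of_mem _ (Finset.mem_Ico.2 ⟨Nat.zero_le _, hi⟩)]
    simp only [initial, dif_pos hi]
    rfl
  -- Outside the array both functions have the default value 0.
  · simp [initial, place, hi]

theorem injOn_initial {n : ℕ} (π : Equiv.Perm (Fin n)) :
    Set.InjOn (initial π).mem (Set.Ico 0 n) := by
  intro i hi j hj hij
  simp only [initial, dif_pos hi.2, dif_pos hj.2] at hij
  simpa using π.injective (Fin.ext hij)

/-- The tolls of BlockQuicksort are summed over the recursion with Hoare's partitioner, where they
can be compared with its comparisons. -/
theorem blockQuicksortMispredictions_le (B : ℕ+) {T : PivotMethod} {k : ℕ}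
    (hT : T.HasConstantSample k) (M n : ℕ) :
    blockQuicksortMispredictions B T M n ≤
      averageTollSum hoarePartition T (blockToll B k M) 0 n (Finset.range n) + 2 := by
  rw [averageTollSum_eq isPartitioner_hoarePartition (isPartitioner_blockPartition B) hT]
  have hfac : (0 : ℝ) < n.factorial := by positivity
  rw [blockQuicksortMispredictions, average, div_le_iff₀ hfac]
  have hsum := Finset.sum_le_sum fun (π : Equiv.Perm (Fin n)) (_ : π ∈ Finset.univ) =>
    sorted_mispredictions_le B hT M 0 n (initial π) (injOn_initial π)
  simp only [Finset.sum_add_distrib, sum_tollSum_initial, Finset.sum_const, Finset.card_univ,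
    Fintype.card_perm, Fintype.card_fin, nsmul_eq_mul] at hsum
  have h₀ : ∀ π : Equiv.Perm (Fin n), ((initial π).mispredictions : ℝ) = 0 := fun π => by
    simp [initial]
  simp only [h₀, Finset.sum_const_zero] at hsum
  refine le_trans hsum (le_of_eq ?_)
  ring

theorem averageTollSum_le_quicksortComparisons {T : PivotMethod} {k : ℕ}
    (hT : T.HasConstantSample k) (M n : ℕ) :
    averageTollSum hoarePartition T (hoareToll M) 0 n (Finset.range n) ≤
      quicksortComparisons T M n := by
  have hfac : (0 : ℝ) < n.factorial := by positivity
  rw [quicksortComparisons, average, le_div_iff₀ hfac, mul_comm, ← sum_tollSum_initial]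
  refine Finset.sum_le_sum fun π _ => ?_
  have h := tollSum_le_sorted_comparisons hT M 0 n (Nat.zero_le n) (initial π) (injOn_initial π)
  have h₀ : ((initial π).comparisons : ℝ) = 0 := by simp [initial]
  rw [h₀, zero_add] at h
  exact h

/-! ### The two bounds of the theorem -/

theorem blockToll_le_hoareToll (B : ℕ+) (k M₀ M N : ℕ) (hN : 1 ≤ N) :
    blockToll B k M N ≤ 6 / (B : ℝ) * hoareToll M₀ N + (5 * M₀ + k + M + 20) := by
  have hB : (1 : ℝ) ≤ (B : ℝ) := by exact_mod_cast B.pos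
  have hN' : (1 : ℝ) ≤ N := by exact_mod_cast hN
  have hM₀ : (0 : ℝ) ≤ M₀ := by positivity
  unfold blockToll hoareToll
  split_ifs with h
  · have h₁ : 5 / (B : ℝ) * ((N : ℝ) - 1) ≤ 6 / (B : ℝ) * ((N : ℝ) - 1) :=
      mul_le_mul_of_nonneg_right (by gcongr; norm_num) (by linarith)
    linarith
  -- Below the threshold no comparisons are credited, but the toll is bounded: this is the origin of
  -- `5 * M₀`.
  · have h₁ : (N : ℝ) ≤ M₀ := by exact_mod_cast not_lt.1 h
    have h₂ : 5 / (B : ℝ) * ((N : ℝ) - 1) ≤ 5 * ((N : ℝ) - 1) :=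
      mul_le_mul_of_nonneg_right (div_le_self (by norm_num) hB) (by linarith)
    linarith

theorem mispredictions_le_comparisons (k M₀ M : ℕ) (B : ℕ+) {T : PivotMethod}
    (hT : T.HasConstantSample k) {n : ℕ} (hn : 1 ≤ n) :
    blockQuicksortMispredictions B T M n ≤
      6 / (B : ℝ) * quicksortComparisons T M₀ n + (5 * M₀ + k + M + 22) * n := by
  have h₁ := blockQuicksortMispredictions_le B hT M n
  have h₂ := averageTollSum_le (part := hoarePartition) (T := T)
    (blockToll_le_hoareToll B k M₀ M) (Nat.zero_le n) (V := Finset.range n) (by simp)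
  have h₃ := mul_le_mul_of_nonneg_left (averageTollSum_le_quicksortComparisons hT M₀ n)
    (show 0 ≤ 6 / (B : ℝ) by positivity)
  have hn' : (1 : ℝ) ≤ n := by exact_mod_cast hn
  push_cast at h₂
  rw [sub_zero] at h₂
  linarith

theorem mispredictions_medianOfThree_lt (M : ℕ) (B : ℕ+) {n : ℕ} (hn : 1 ≤ n) :
    blockQuicksortMispredictions B medianOfThree M n <
      8 / (B : ℝ) * (n * Real.logb 2 n) + (M + 26) * n := by
  have h₁ := blockQuicksortMispredictions_le B hasConstantSample_medianOfThree M n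
  have h₂ := averageTollSum_le (part := hoarePartition) (T := medianOfThree)
    (τ := blockToll B 3 M) (τ' := fun N => (N : ℝ) - 1) (a := 5 / (B : ℝ)) (K := 3 + M + 20)
    (fun N _ => le_of_eq (by unfold blockToll; push_cast; rfl)) (Nat.zero_le n)
    (V := Finset.range n) (by simp)
  have h₃ := averageTollSum_medianOfThree_le isPartitioner_hoarePartition 0 n
    (V := Finset.range n) (by simp)
  rw [Nat.sub_zero] at h₃
  push_cast at h₂
  rw [sub_zero] at h₂
  have hn' : (1 : ℝ) ≤ n := by exact_mod_cast hn
  have hlog : 0 ≤ (n : ℝ) * Real.log n := by positivity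
  have h₄ := mul_le_mul_of_nonneg_left h₃ (show 0 ≤ 5 / (B : ℝ) by positivity)
  have h₅ : 5 / (B : ℝ) * (2 * (n * Real.log n)) ≤ 8 / (B : ℝ) * (n * Real.logb 2 n) := by
    have hl2 : 0 < Real.log 2 := Real.log_pos (by norm_num)
    -- Passing to base 2 turns the claim into `10 * ln 2 ≤ 8`. Strictness of the final bound comes
    -- from the linear term, where 23 + 2 < 26.
    have hle : 5 * (2 * (n * Real.log n)) ≤ 8 * (n * Real.logb 2 n) := by
      rw [Real.logb, ← mul_div_assoc, ← mul_div_assoc, le_div_iff₀ hl2]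
      have := Real.log_two_lt_d9
      nlinarith
    rw [div_mul_eq_mul_div, div_mul_eq_mul_div]
    gcongr
  linarith

end BlockQuicksort

theorem theorem1 :
    (∀ k M₀ M : ℕ, ∃ K : ℝ, ∀ (B : ℕ+) (T : BlockQuicksort.PivotMethod), T.HasConstantSample k →
      ∀ n : ℕ, 1 ≤ n →
        BlockQuicksort.blockQuicksortMispredictions B T M n ≤
          6 / (B : ℝ) * BlockQuicksort.quicksortComparisons T M₀ n + K * n) ∧
    (∀ M : ℕ, ∃ K : ℝ, ∀ (B : ℕ+) (n : ℕ), 1 ≤ n →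
      BlockQuicksort.blockQuicksortMispredictions B BlockQuicksort.medianOfThree M n <
        8 / (B : ℝ) * (n * Real.logb 2 n) + K * n) :=
  -- The constants are found by unification: `5 * M₀ + k + M + 22` for (a) and `M + 26` for (b),
  -- neither depending on `B`.
  ⟨fun k M₀ M => ⟨_, fun B _ hT _ hn =>
      BlockQuicksort.mispredictions_le_comparisons k M₀ M B hT hn⟩,
    fun M => ⟨_, fun B _ hn => BlockQuicksort.mispredictions_medianOfThree_lt M B hn⟩⟩
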